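/- **Notation.** Let $n\ge 1$ and let $\alpha\ge -1/n$ be a real number. For $u,v,s,t>0$ and $p\in[-\infty,\infty)$ let $M_p^{(s,t)}(u,v)=(su^p+tv^p)^{1/p}$ if $p\ne 0,-\infty$, $M_0^{(s,t)}(u,v)=u^sv^t$ and $M_{-\infty}^{(s,t)}(u,v)=\min\{u,v\}$. For $f:\mathbb R^n\to[0,\infty)$ put $\operatorname{supp} f=\{f>0\}$. Let $\mathcal C_\alpha(\mathbb R^n)$ be the class of upper semicontinuous $f:\mathbb R^n\to[0,\infty)$ with $f(x)\to0$ as $\|x\|\to\infty$ such that $\operatorname{supp} f$ is convex and of dimension $n$, and $f(\lambda x+(1-\lambda)y)\ge M_\alpha^{(\lambda,1-\lambda)}(f(x),f(y))$ for all $x,y\in\operatorname{supp} f$ and $\lambda\in[0,1]$ (for $\lambda\in\{0,1\}$ the mean is given by the same formula). For $f\in\mathcal C_\alpha(\mathbb R^n)$ the base function $\operatorname{base}_\alpha f:\mathbb R^n\to(-\infty,\infty]$ is $(1-f^\alpha)/\alpha$ for $\alpha\neq0$ and $-\log f$ for $\alpha=0$, where for $\alpha\le 0$ the value is $+\infty$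 at the zeros of $f$, and for $\alpha>0$ the formula is used on the closure of $\operatorname{supp} f$ and the value is $+\infty$ elsewhere. Thus $f=(1-\alpha\operatorname{base}_\alpha f)_+^{1/\alpha}$ (respectively $f=e^{-\operatorname{base}_0 f}$), where the right-hand side is read as $0$ where the base function is $+\infty$. Write $(\varphi\,\square\,\psi)(x)=\inf_{y+z=x}\{\varphi(y)+\psi(z)\}$ and $(\lambda\bullet\psi)(x)=\lambda\psi(x/\lambda)$ for $\lambda>0$. The functions $f\star_\alpha g$ and $\lambda\cdot_\alpha f$ are those with base functions $\operatorname{base}_\alpha f\,\square\,\operatorname{base}_\alpha g$ and $\lambda\bullet\operatorname{base}_\alpha f$. For a unit vector $u$ let $R_u$ be the reflection about $u^\perp$ and let $\tau_u\psi=(\tfrac12\bullet\psi)\,\square\,(\tfrac12\bullet(\psi\circ R_u))$. A sequence $\psi_j$ *epi-converges* to $\psi$ if for every $x$ one has $\psi(x)\le\liminf_j\psi_j(x_j)$ whenever $x_j\to x$, and $\psi(x)=\lim_j\psi_j(x_j)$ for at least one sequence $x_j\to x$; *hypo-convergence* $f_j\to f$ is defined likewise, with $f(x)\ge\limsup_j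 f_j(x_j)$ in place of the first condition. A function $g$ is a *hypo-symmetrization* $f_{\rm sym}$ of $f\in\mathcal C_\alpha(\mathbb R^n)$ if $g=(1-\alpha\varphi)_+^{1/\alpha}$ ($g=e^{-\varphi}$ if $\alpha=0$), where $\varphi:\mathbb R^n\to(-\infty,\infty]$ is convex, lower semicontinuous, coercive, not identically $+\infty$, invariant under orthogonal transformations, and is the epi-limit of $\tau_{u_m}\cdots\tau_{u_1}\operatorname{base}_\alpha f$ as $m\to\infty$ for some sequence $(u_i)$ of unit vectors. Put $p=\frac{\alpha}{n+\alpha}$ (with $p=-\infty$ if $n=1$ and $\alpha=-1$). **Theorem.** Every $f\in\mathcal C_\alpha(\mathbb R^n)$ has a hypo-symmetrization $f_{\rm sym}$, and every hypo-symmetrization of $f$ belongs to $\mathcal C_\alpha(\mathbb R^n)$. Let $F:\mathcal C_\alpha(\mathbb R^n)\to(0,\infty)$ be invariant under orthogonal transformations, that is, $F(f\circ T)=F(f)$ for all $f\in\mathcal C_\alpha(\mathbb R^n)$ and $T\in O(n)$. 1. Suppose that $F$ is lower semicontinuous with respect to hypo-convergence, that is, $F(f)\le\liminf_jF(f_j)$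 whenever $f_j,f\in\mathcal C_\alpha(\mathbb R^n)$ and $f_j$ hypo-converges to $f$, and that $F$ is $p$-convex with respect to $\alpha$-sup-convolution, that is, $$F\big(\lambda\cdot_\alpha f\star_\alpha(1-\lambda)\cdot_\alpha g\big)\le M_p^{(\lambda,1-\lambda)}\big(F(f),F(g)\big)\qquad\text{for all } f,g\in\mathcal C_\alpha(\mathbb R^n),\ \lambda\in(0,1).$$ Then $F(f)\ge F(f_{\rm sym})$ for every $f\in\mathcal C_\alpha(\mathbb R^n)$ and every hypo-symmetrization $f_{\rm sym}$ of $f$. 2. Suppose that $F$ is upper semicontinuous with respect to hypo-convergence, that is, $F(f)\ge\limsup_jF(f_j)$ whenever $f_j,f\in\mathcal C_\alpha(\mathbb R^n)$ and $f_j$ hypo-converges to $f$, and $p$-concave with respect to $\alpha$-sup-convolution, that is, the displayed inequality holds with $\ge$ in place of $\le$. Then $F(f)\le F(f_{\rm sym})$ for every $f\in\mathcal C_\alpha(\mathbb R^n)$ and every hypo-symmetrization $f_{\rm sym}$ of $f$. -/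

import Mathlib

open Filter Topology

noncomputable section

namespace HypoSym

/-- Euclidean space `ℝⁿ`. -/
abbrev E (n : ℕ) : Type := EuclideanSpace ℝ (Fin n)

/-- The weighted mean `M_p^{(s,t)}(u,v)` of positive numbers, for `p ∈ [-∞, ∞]`. -/
def mean (p : EReal) (s t u v : ℝ) : ℝ :=
  open Classical in
  if p = ⊥ then min u v
  else if p = ⊤ then max u v
  else if p = 0 then u ^ s * v ^ t
  else (s * u ^ p.toReal + t * v ^ p.toReal) ^ (1 / p.toReal)

/-- The support `{f > 0}`; no closure is taken. -/
def supp {n : ℕ} (f : E n → ℝ) : Set (E n) := {x | 0 < f x}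

/-- `α`-concavity of a function. -/
def AlphaConcave {n : ℕ} (α : ℝ) (f : E n → ℝ) : Prop :=
  Convex ℝ (supp f) ∧
    ∀ x ∈ supp f, ∀ y ∈ supp f, ∀ l ∈ Set.Icc (0 : ℝ) 1,
      mean (α : EReal) l (1 - l) (f x) (f y) ≤ f (l • x + (1 - l) • y)

/-- The class `C_α(ℝⁿ)`. -/
structure MemC {n : ℕ} (α : ℝ) (f : E n → ℝ) : Prop where
  nonneg : ∀ x, 0 ≤ f x
  alphaConcave : AlphaConcave α f
  proper : (supp f).Nonempty
  usc : UpperSemicontinuous f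
  /-- The support has dimension `n`. -/
  fullDim : affineSpan ℝ (supp f) = ⊤
  tendsto_zero : Tendsto f (cocompact (E n)) (𝓝 0)

/-- The base function: `(1 - f ^ α) / α`, or `-log f` if `α = 0`, as a lower semicontinuous convex
function with values in `(-∞, ∞]`. Off the support it is `∞`, except that for `α > 0` it takes its
limit value `1 / α` at the boundary points of the support at which `f` vanishes. -/
def base {n : ℕ} (α : ℝ) (f : E n → ℝ) (x : E n) : EReal :=
  open Classical in
  if 0 < α then
    if x ∈ closure (supp f) then (((1 - f x ^ α) / α : ℝ) : EReal) else ⊤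
  else if 0 < f x then
    if α = 0 then ((-Real.log (f x) : ℝ) : EReal) else (((1 - f x ^ α) / α : ℝ) : EReal)
  else ⊤

/-- The function `(1 - α ψ)₊ ^ (1 / α)`, or `exp (-ψ)` if `α = 0`, with value `0` where
`ψ = ∞`. -/
def ofBase {n : ℕ} (α : ℝ) (ψ : E n → EReal) (x : E n) : ℝ :=
  open Classical in
  if ψ x = ⊤ then 0
  else if α = 0 then Real.exp (-(ψ x).toReal)
  else (max (1 - α * (ψ x).toReal) 0) ^ (1 / α)

/-- Infimal convolution. -/
def infConv {n : ℕ} (φ ψ : E n → EReal) (x : E n) : EReal := ⨅ y, φ y + ψ (x - y)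

/-- Epi-multiplication by `l > 0`. -/
def epiMul {n : ℕ} (l : ℝ) (ψ : E n → EReal) (x : E n) : EReal := (l : EReal) * ψ (l⁻¹ • x)

/-- The `α`-Asplund sum `f ⋆_α g`. -/
def asplund {n : ℕ} (α : ℝ) (f g : E n → ℝ) : E n → ℝ :=
  ofBase α (infConv (base α f) (base α g))

/-- The `(α, l)`-homothety `l ·_α f`. -/
def homothety {n : ℕ} (α l : ℝ) (f : E n → ℝ) : E n → ℝ := ofBase α (epiMul l (base α f))

/-- The reflection of `x` about `u^⊥`, for a unit vector `u`. -/
def reflect {n : ℕ} (u x : E n) : E n := x - (2 * inner ℝ x u) • u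

/-- The Minkowski symmetral of a convex function. -/
def minkSym {n : ℕ} (u : E n) (ψ : E n → EReal) : E n → EReal :=
  infConv (epiMul (1 / 2) ψ) (epiMul (1 / 2) (fun x => ψ (reflect u x)))

/-- Successive Minkowski symmetrizations, in the directions `u 0, …, u (m - 1)` in this order. -/
def iterSym {n : ℕ} (u : ℕ → E n) (ψ : E n → EReal) : ℕ → E n → EReal
  | 0 => ψ
  | m + 1 => minkSym (u m) (iterSym u ψ m)

/-- Epi-convergence. -/
def EpiTendsto {n : ℕ} (ψs : ℕ → E n → EReal) (ψ : E n → EReal) : Prop :=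
  ∀ x : E n,
    (∀ xs : ℕ → E n, Tendsto xs atTop (𝓝 x) → ψ x ≤ liminf (fun j => ψs j (xs j)) atTop) ∧
    ∃ xs : ℕ → E n, Tendsto xs atTop (𝓝 x) ∧ Tendsto (fun j => ψs j (xs j)) atTop (𝓝 (ψ x))

/-- Hypo-convergence. -/
def HypoTendsto {n : ℕ} (fs : ℕ → E n → ℝ) (f : E n → ℝ) : Prop :=
  ∀ x : E n,
    (∀ xs : ℕ → E n, Tendsto xs atTop (𝓝 x) →
      limsup (fun j => (fs j (xs j) : EReal)) atTop ≤ (f x : EReal)) ∧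
    ∃ xs : ℕ → E n, Tendsto xs atTop (𝓝 x) ∧ Tendsto (fun j => fs j (xs j)) atTop (𝓝 (f x))

/-- The class of convex, coercive, proper, lower semicontinuous functions. -/
structure MemConvC {n : ℕ} (ψ : E n → EReal) : Prop where
  convex_epi : Convex ℝ {p : E n × ℝ | ψ p.1 ≤ (p.2 : EReal)}
  coercive : Tendsto ψ (cocompact (E n)) (𝓝 ⊤)
  ne_bot : ∀ x, ψ x ≠ ⊥
  dom_nonempty : ∃ x, ψ x ≠ ⊤
  lsc : LowerSemicontinuous ψ

/-- `φ` is an epi-symmetrization of `ψ`: a function in `Conv_c(ℝⁿ)`, invariant under orthogonal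
transformations, which is the epi-limit of a sequence of successive Minkowski symmetrizations of
`ψ`. -/
def IsEpiSymmetrization {n : ℕ} (ψ φ : E n → EReal) : Prop :=
  MemConvC φ ∧ (∀ (T : E n ≃ₗᵢ[ℝ] E n) (x : E n), φ (T x) = φ x) ∧
    ∃ u : ℕ → E n, (∀ i, ‖u i‖ = 1) ∧ EpiTendsto (iterSym u ψ) φ

/-- `g` is a hypo-symmetrization `f_sym` of `f`: its base function is an epi-symmetrization of the
base function of `f`. -/
def IsHypoSymmetrization {n : ℕ} (α : ℝ) (f g : E n → ℝ) : Prop :=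
  ∃ φ : E n → EReal, IsEpiSymmetrization (base α f) φ ∧ g = ofBase α φ

/-- The exponent `α / (n + α)`; it is `-∞`, its limit as `α ↓ -1`, if `n = 1` and `α = -1`. -/
def exponent (n : ℕ) (α : ℝ) : EReal :=
  open Classical in
  if (n : ℝ) + α = 0 then ⊥ else ((α / ((n : ℝ) + α) : ℝ) : EReal)

/-! Properties of a functional `F` on `C_α(ℝⁿ)`; its values at other functions are irrelevant. -/

/-- `F` takes values in `(0, ∞)`. -/
def PosOn {n : ℕ} (α : ℝ) (F : (E n → ℝ) → ℝ) : Prop := ∀ f, MemC α f → 0 < F f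

/-- `F` is invariant under orthogonal transformations. -/
def OrthInvariant {n : ℕ} (α : ℝ) (F : (E n → ℝ) → ℝ) : Prop :=
  ∀ f, MemC α f → ∀ T : E n ≃ₗᵢ[ℝ] E n, F (fun x => f (T x)) = F f

/-- `F` is lower semicontinuous with respect to hypo-convergence. -/
def HypoLSC {n : ℕ} (α : ℝ) (F : (E n → ℝ) → ℝ) : Prop :=
  ∀ (fs : ℕ → E n → ℝ) (f : E n → ℝ), (∀ j, MemC α (fs j)) → MemC α f → HypoTendsto fs f →
    (F f : EReal) ≤ liminf (fun j => (F (fs j) : EReal)) atTop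

/-- `F` is upper semicontinuous with respect to hypo-convergence. -/
def HypoUSC {n : ℕ} (α : ℝ) (F : (E n → ℝ) → ℝ) : Prop :=
  ∀ (fs : ℕ → E n → ℝ) (f : E n → ℝ), (∀ j, MemC α (fs j)) → MemC α f → HypoTendsto fs f →
    limsup (fun j => (F (fs j) : EReal)) atTop ≤ (F f : EReal)

/-- `F` is `α / (n + α)`-convex with respect to `α`-sup-convolution. -/
def SupConvConvex {n : ℕ} (α : ℝ) (F : (E n → ℝ) → ℝ) : Prop :=
  ∀ f g, MemC α f → MemC α g → ∀ l ∈ Set.Ioo (0 : ℝ) 1,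
    F (asplund α (homothety α l f) (homothety α (1 - l) g))
      ≤ mean (exponent n α) l (1 - l) (F f) (F g)

/-- `F` is `α / (n + α)`-concave with respect to `α`-sup-convolution. -/
def SupConvConcave {n : ℕ} (α : ℝ) (F : (E n → ℝ) → ℝ) : Prop :=
  ∀ f g, MemC α f → MemC α g → ∀ l ∈ Set.Ioo (0 : ℝ) 1,
    mean (exponent n α) l (1 - l) (F f) (F g)
      ≤ F (asplund α (homothety α l f) (homothety α (1 - l) g))

end HypoSym

end

open Filter Topology

noncomputable section

namespace HypoSym

variable {n : ℕ}

/-! ### Reflections -/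

/-! The inequalities for `F`. Passing to the base function turns `α`-concavity into convexity, and
the combination of `f` and `f ∘ R_u` with weights 1/2 into the Minkowski symmetral of the base
function (`asplund_homothety_half`). By invariance `F` takes the same value at `f` and at `f ∘ R_u`,
and every mean of two equal numbers with weights 1/2 is that number (`mean_half_self`). Hence `F` is
monotone along successive symmetrizations. Base functions of `C_α` are captured by `MemBase`, a
class with bounds that symmetrization preserves and that pass to epi-limits (`MemBase.minkSym`,
`MemBase.of_epiTendsto`). On it the passage between functions and base functions is invertible
(`MemBase.base_ofBase`) and turns epi-convergence into hypo-convergence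
(`HypoTendsto.of_epiTendsto`), so semicontinuity of `F` carries the inequality to the limit.

Existence of a symmetrization. Under convex conjugation a symmetrization step replaces a conjugate
`h` with domain `D` by `(h + h ∘ R_u) / 2` with domain `D ∩ R_u D` (`slopes_minkSym`,
`conj_minkSym`). Let `ρ` be the radius of the largest open ball about the origin inside the initial
domain; it is positive by coercivity. On smaller closed balls all conjugates share one modulus of
continuity, and finitely many averages make them nearly radial (`exists_list_hasOsc`). For radii
above `ρ`, finitely many reflections spread one missing point of the domain around a whole sphere
(`exists_list_subset_closedBall`). Both gains survive further steps, so one sequence of directions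
secures them for all rational radii and tolerances (`exists_seq_forall_eventually`,
`exists_isGoodSeq`).

The conjugates then converge, locally uniformly inside the ball of radius `ρ`, to a radial function,
and the epi-limit is the conjugate of that function restricted to the ball. The lower half of
epi-convergence is Fenchel's inequality. The upper half is a separation argument
(`exists_conj_add_le`, `IsGoodSeq.eventually_exists_lt`), in which slopes of norm close to or beyond
`ρ` are shrunk towards the origin. -/

theorem reflect_eq_reflection {u : E n} (hu : ‖u‖ = 1) (x : E n) :
    reflect u x = (ℝ ∙ u)ᗮ.reflection x := by
  rw [Submodule.reflection_orthogonal_apply, Submodule.reflection_apply,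
    Submodule.starProjection_unit_singleton ℝ hu, reflect, real_inner_comm]
  module

/-- The reflection about `u^⊥` as a linear isometry. -/
def reflectIso (u : E n) : E n ≃ₗᵢ[ℝ] E n := (ℝ ∙ u)ᗮ.reflection

theorem reflectIso_apply {u : E n} (hu : ‖u‖ = 1) (x : E n) : reflectIso u x = reflect u x :=
  (reflect_eq_reflection hu x).symm

theorem norm_reflect {u : E n} (hu : ‖u‖ = 1) (x : E n) : ‖reflect u x‖ = ‖x‖ := by
  rw [← reflectIso_apply hu, LinearIsometryEquiv.norm_map]

theorem reflect_reflect {u : E n} (hu : ‖u‖ = 1) (x : E n) : reflect u (reflect u x) = x := by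
  rw [reflect_eq_reflection hu, reflect_eq_reflection hu, Submodule.reflection_reflection]

theorem reflect_sub (u x y : E n) : reflect u (x - y) = reflect u x - reflect u y := by
  simp only [reflect, inner_sub_left]
  module

theorem reflect_add (u x y : E n) : reflect u (x + y) = reflect u x + reflect u y := by
  simp only [reflect, inner_add_left]
  module

theorem reflect_smul (u x : E n) (c : ℝ) : reflect u (c • x) = c • reflect u x := by
  simp only [reflect, inner_smul_left, RCLike.conj_to_real]
  module

theorem norm_reflect_sub {u : E n} (hu : ‖u‖ = 1) (x y : E n) :
    ‖reflect u x - reflect u y‖ = ‖x - y‖ := by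
  rw [← reflect_sub, norm_reflect hu]

theorem inner_reflect_left (u x y : E n) :
    inner ℝ (reflect u x) y = inner ℝ x (reflect u y) := by
  simp only [reflect, inner_sub_left, inner_sub_right, inner_smul_left, inner_smul_right,
    RCLike.conj_to_real, real_inner_comm u y]
  ring

theorem continuous_reflect (u : E n) : Continuous (reflect u) := by
  unfold reflect
  fun_prop

/-- Distinct points of the same norm are exchanged by a reflection. -/
theorem exists_reflect_eq {x y : E n} (hxy : ‖x‖ = ‖y‖) (hne : x ≠ y) :
    ∃ u : E n, ‖u‖ = 1 ∧ reflect u x = y := by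
  have h0 : ‖x - y‖ ≠ 0 := norm_ne_zero_iff.2 (sub_ne_zero.2 hne)
  refine ⟨‖x - y‖⁻¹ • (x - y), ?_, ?_⟩
  · rw [norm_smul, norm_inv, norm_norm, inv_mul_cancel₀ h0]
  · have h1 : 2 * inner ℝ x (x - y) = ‖x - y‖ ^ 2 := by
      rw [@norm_sub_sq_real, inner_sub_right, real_inner_self_eq_norm_sq, hxy]
      ring
    have h2 : (2 * inner ℝ x (‖x - y‖⁻¹ • (x - y))) • ‖x - y‖⁻¹ • (x - y) = x - y := by
      rw [inner_smul_right, smul_smul]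
      have : 2 * (‖x - y‖⁻¹ * inner ℝ x (x - y)) * ‖x - y‖⁻¹ = 1 := by
        have : 2 * (‖x - y‖⁻¹ * inner ℝ x (x - y)) * ‖x - y‖⁻¹
            = (2 * inner ℝ x (x - y)) * (‖x - y‖⁻¹ * ‖x - y‖⁻¹) := by ring
        rw [this, h1]
        field_simp
      rw [this, one_smul]
    rw [reflect, h2, sub_sub_cancel]

/-! ### Half multiples in the extended reals -/

theorem half_mul_add_half_mul_lt {a b : EReal} (ha : a ≠ ⊥) (hb : b ≠ ⊥) {t : ℝ}
    (h : ((1 / 2 : ℝ) : EReal) * a + ((1 / 2 : ℝ) : EReal) * b < t) :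
    ∃ s s' : ℝ, a < s ∧ b < s' ∧ t = (s + s') / 2 := by
  have h2 : (0 : ℝ) < 1 / 2 := by norm_num
  induction a with
  | bot => exact absurd rfl ha
  | top =>
    rw [EReal.coe_mul_top_of_pos h2, EReal.top_add_of_ne_bot] at h
    · exact absurd h (not_lt.2 le_top)
    · induction b with
      | bot => exact absurd rfl hb
      | top => rw [EReal.coe_mul_top_of_pos h2]; exact top_ne_bot
      | coe b => rw [← EReal.coe_mul]; exact EReal.coe_ne_bot _
  | coe a =>
    induction b with
    | bot => exact absurd rfl hb
    | top =>
      rw [EReal.coe_mul_top_of_pos h2, ← EReal.coe_mul, EReal.coe_add_top] at h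
      exact absurd h (not_lt.2 le_top)
    | coe b =>
      rw [← EReal.coe_mul, ← EReal.coe_mul, ← EReal.coe_add, EReal.coe_lt_coe_iff] at h
      -- Adding the whole slack to both numbers raises their average by exactly the slack.
      refine ⟨a + (t - (1 / 2 * a + 1 / 2 * b)), b + (t - (1 / 2 * a + 1 / 2 * b)), ?_, ?_, ?_⟩
      · rw [EReal.coe_lt_coe_iff]; linarith
      · rw [EReal.coe_lt_coe_iff]; linarith
      · ring

theorem half_mul_add_half_mul_le {a b : EReal} {s s' : ℝ} (ha : a ≤ s) (hb : b ≤ s') :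
    ((1 / 2 : ℝ) : EReal) * a + ((1 / 2 : ℝ) : EReal) * b ≤ (((s + s') / 2 : ℝ) : EReal) := by
  have h2 : (0 : EReal) ≤ ((1 / 2 : ℝ) : EReal) := by
    rw [EReal.coe_nonneg]; norm_num
  calc _ ≤ ((1 / 2 : ℝ) : EReal) * s + ((1 / 2 : ℝ) : EReal) * s' :=
        add_le_add (mul_le_mul_of_nonneg_left ha h2) (mul_le_mul_of_nonneg_left hb h2)
    _ = _ := by
        rw [← EReal.coe_mul, ← EReal.coe_mul, ← EReal.coe_add]
        congr 1
        ring

theorem half_mul_le_iff {a : EReal} {t : ℝ} :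
    ((1 / 2 : ℝ) : EReal) * a ≤ t ↔ a ≤ ((2 * t : ℝ) : EReal) := by
  have h2 : (0 : ℝ) < 1 / 2 := by norm_num
  induction a with
  | bot => rw [EReal.coe_mul_bot_of_pos h2]; simp only [bot_le]
  | top => rw [EReal.coe_mul_top_of_pos h2, top_le_iff, top_le_iff]; simp only [EReal.coe_ne_top]
  | coe a =>
    rw [← EReal.coe_mul, EReal.coe_le_coe_iff, EReal.coe_le_coe_iff]
    constructor <;> intro h <;> linarith

/-! ### The Minkowski symmetral -/

theorem minkSym_le {ψ : E n → EReal} {u : E n} (hu : ‖u‖ = 1) {a b : E n} {s s' : ℝ}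
    (ha : ψ a ≤ s) (hb : ψ b ≤ s') :
    minkSym u ψ ((1 / 2 : ℝ) • (a + reflect u b)) ≤ (((s + s') / 2 : ℝ) : EReal) := by
  refine (iInf_le _ ((1 / 2 : ℝ) • a)).trans ?_
  have e1 : ((1 / 2 : ℝ)⁻¹ • (1 / 2 : ℝ) • a) = a := by
    rw [smul_smul]; norm_num
  have e2 : reflect u ((1 / 2 : ℝ)⁻¹ • ((1 / 2 : ℝ) • (a + reflect u b) - (1 / 2 : ℝ) • a)) = b := by
    rw [smul_add, add_sub_cancel_left, smul_smul]
    norm_num [reflect_reflect hu]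
  simp only [epiMul]
  rw [e1, e2]
  exact half_mul_add_half_mul_le ha hb

/-- Together with `minkSym_le`, this describes the symmetral by averaging the epigraph with its
reflection. The inequalities here are strict because no minimizer of the infimal convolution is at
hand. -/
theorem exists_of_minkSym_lt {ψ : E n → EReal} (hψ : ∀ x, ψ x ≠ ⊥) {u : E n} (hu : ‖u‖ = 1)
    {x : E n} {t : ℝ} (h : minkSym u ψ x < t) :
    ∃ (a b : E n) (s s' : ℝ), ψ a < s ∧ ψ b < s' ∧ x = (1 / 2 : ℝ) • (a + reflect u b) ∧
      t = (s + s') / 2 := by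
  obtain ⟨y, hy⟩ := iInf_lt_iff.1 h
  obtain ⟨s, s', h1, h2, h3⟩ := half_mul_add_half_mul_lt (hψ _) (hψ _) hy
  refine ⟨_, _, s, s', h1, h2, ?_, h3⟩
  rw [reflect_reflect hu, ← smul_add, add_sub_cancel, smul_smul]
  norm_num

theorem coe_le_minkSym {ψ : E n → EReal} {c : ℝ} (h : ∀ x, (c : EReal) ≤ ψ x) {u : E n}
    (hu : ‖u‖ = 1) (x : E n) : (c : EReal) ≤ minkSym u ψ x := by
  by_contra! hlt
  have hb : ∀ x, ψ x ≠ ⊥ := fun x hx => by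
    have := h x
    rw [hx] at this
    exact absurd this (not_le.2 (EReal.bot_lt_coe c))
  obtain ⟨a, b, s, s', h1, h2, -, h3⟩ := exists_of_minkSym_lt hb hu hlt
  have h4 := EReal.coe_lt_coe_iff.1 ((h a).trans_lt h1)
  have h5 := EReal.coe_lt_coe_iff.1 ((h b).trans_lt h2)
  linarith

theorem isCompact_sublevel {ψ : E n → EReal} (hψ : MemConvC ψ) (t : ℝ) :
    IsCompact {x | ψ x ≤ t} := by
  have hcl : IsClosed {x | ψ x ≤ t} := lowerSemicontinuous_iff_isClosed_preimage.1 hψ.lsc _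
  have h := EReal.tendsto_nhds_top_iff_real.1 hψ.coercive t
  obtain ⟨K, hK, hKs⟩ := mem_cocompact.1 h
  refine hK.of_isClosed_subset hcl fun x hx => ?_
  by_contra hxK
  exact absurd (show (t : EReal) < ψ x from hKs hxK) (not_lt.2 hx)

theorem exists_lower_bound {ψ : E n → EReal} (hψ : MemConvC ψ) :
    ∃ x₀, ψ x₀ ≠ ⊤ ∧ ∀ x, ψ x₀ ≤ ψ x := by
  obtain ⟨x₁, hx₁⟩ := hψ.dom_nonempty
  have hx₁' : ψ x₁ = ((ψ x₁).toReal : EReal) := (EReal.coe_toReal hx₁ (hψ.ne_bot _)).symm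
  obtain ⟨x₀, hx₀, hmin⟩ := (hψ.lsc.lowerSemicontinuousOn _).exists_isMinOn
    (s := {x | ψ x ≤ ((ψ x₁).toReal : EReal)}) ⟨x₁, hx₁'.le⟩ (isCompact_sublevel hψ _)
  refine ⟨x₀, ne_top_of_le_ne_top (EReal.coe_ne_top _) hx₀, fun x => ?_⟩
  by_cases hx : ψ x ≤ ((ψ x₁).toReal : EReal)
  · exact hmin hx
  · exact le_trans hx₀ (not_le.1 hx).le

theorem ne_bot_of_coe_le {a : EReal} {c : ℝ} (h : (c : EReal) ≤ a) : a ≠ ⊥ :=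
  ((EReal.bot_lt_coe c).trans_le h).ne'

theorem MemConvC.exists_coe_le {ψ : E n → EReal} (hψ : MemConvC ψ) :
    ∃ c : ℝ, ∀ x, (c : EReal) ≤ ψ x := by
  obtain ⟨x₀, h, hmin⟩ := exists_lower_bound hψ
  exact ⟨(ψ x₀).toReal, fun x => (EReal.coe_toReal h (hψ.ne_bot _)).le.trans (hmin x)⟩

/-- The set of midpoints `(a + R_u b) / 2` with `ψ a ≤ s`, `ψ b ≤ s'` and `s + s' = 2 t`. -/
def midpointLevel (u : E n) (ψ : E n → EReal) (t : ℝ) : Set (E n) :=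
  {x | ∃ (a b : E n) (s s' : ℝ), ψ a ≤ s ∧ ψ b ≤ s' ∧ x = (1 / 2 : ℝ) • (a + reflect u b) ∧
      t = (s + s') / 2}

/-- A lower bound `c` of `ψ` forces `s, s' ≤ 2 t - c`, so only a compact piece of the epigraph
contributes and the set is a continuous image of a compact set. -/
theorem isCompact_midpointLevel {ψ : E n → EReal} (hψ : MemConvC ψ) (u : E n) (t : ℝ) :
    IsCompact (midpointLevel u ψ t) := by
  obtain ⟨c, hc⟩ := hψ.exists_coe_le
  have hepi : IsClosed {p : E n × ℝ | ψ p.1 ≤ (p.2 : EReal)} :=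
    hψ.lsc.isClosed_epigraph.preimage (f := fun p : E n × ℝ => (p.1, (p.2 : EReal)))
      (continuous_fst.prodMk (continuous_coe_real_ereal.comp continuous_snd))
  have hK : IsCompact (({x | ψ x ≤ ((2 * t - c : ℝ) : EReal)} ×ˢ Set.Icc c (2 * t - c)) ∩
      {p : E n × ℝ | ψ p.1 ≤ (p.2 : EReal)}) :=
    ((isCompact_sublevel hψ _).prod isCompact_Icc).inter_right hepi
  have hKK := (hK.prod hK).inter_right
    (isClosed_eq (f := fun q : (E n × ℝ) × (E n × ℝ) => (q.1.2 + q.2.2) / 2)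
      (g := fun _ => t) (by fun_prop) (by fun_prop))
  have him := hKK.image (f := fun q : (E n × ℝ) × (E n × ℝ) =>
    (1 / 2 : ℝ) • (q.1.1 + reflect u q.2.1))
    (by have := continuous_reflect u; fun_prop)
  convert him using 1
  ext x
  constructor
  · rintro ⟨a, b, s, s', ha, hb, hx, ht⟩
    have h1 := EReal.coe_le_coe_iff.1 ((hc a).trans ha)
    have h2 := EReal.coe_le_coe_iff.1 ((hc b).trans hb)
    refine ⟨((a, s), (b, s')), ⟨⟨⟨⟨?_, ?_, ?_⟩, ha⟩, ⟨⟨?_, ?_, ?_⟩, hb⟩⟩, ht.symm⟩, hx.symm⟩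
    · exact ha.trans (EReal.coe_le_coe_iff.2 (by linarith))
    · exact h1
    · show s ≤ _
      linarith
    · exact hb.trans (EReal.coe_le_coe_iff.2 (by linarith))
    · exact h2
    · show s' ≤ _
      linarith
  · rintro ⟨⟨⟨a, s⟩, ⟨b, s'⟩⟩, ⟨⟨⟨-, ha⟩, ⟨-, hb⟩⟩, ht⟩, hx⟩
    exact ⟨a, b, s, s', ha, hb, hx.symm, ht.symm⟩

theorem mem_midpointLevel_of_lt {ψ : E n → EReal} (hψ : ∀ x, ψ x ≠ ⊥) {u : E n} (hu : ‖u‖ = 1)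
    {x : E n} {t : ℝ} (h : minkSym u ψ x < t) : x ∈ midpointLevel u ψ t := by
  obtain ⟨a, b, s, s', h1, h2, h3, h4⟩ := exists_of_minkSym_lt hψ hu h
  exact ⟨a, b, s, s', h1.le, h2.le, h3, h4⟩

theorem minkSym_le_of_mem {ψ : E n → EReal} {u : E n} (hu : ‖u‖ = 1)
    {x : E n} {t : ℝ} (h : x ∈ midpointLevel u ψ t) : minkSym u ψ x ≤ t := by
  obtain ⟨a, b, s, s', h1, h2, rfl, rfl⟩ := h
  exact minkSym_le hu h1 h2

theorem le_coe_of_forall_lt {a : EReal} {t : ℝ} (h : ∀ ε > 0, a < ((t + ε : ℝ) : EReal)) :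
    a ≤ t := by
  by_contra! hlt
  obtain ⟨r, h1, h2⟩ := EReal.lt_iff_exists_real_btwn.1 hlt
  have := h (r - t) (by have := EReal.coe_lt_coe_iff.1 h1; linarith)
  rw [add_sub_cancel] at this
  exact absurd this (not_lt.2 h2.le)

/-- Convexity comes from averaging epigraphs. Coercivity and lower semicontinuity come from
squeezing the compact set `midpointLevel u ψ t` between the strict and the weak sublevel set at
height `t`. -/
theorem MemConvC.minkSym {ψ : E n → EReal} (hψ : MemConvC ψ) {u : E n} (hu : ‖u‖ = 1) :
    MemConvC (minkSym u ψ) where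
  convex_epi := by
    rintro ⟨x, t⟩ hx ⟨y, r⟩ hy p q hp hq hpq
    simp only [Set.mem_ofPred_eq, Prod.smul_mk, Prod.mk_add_mk, smul_eq_mul] at hx hy ⊢
    refine le_coe_of_forall_lt fun ε hε => ?_
    have hx' : HypoSym.minkSym u ψ x < ((t + ε / 2 : ℝ) : EReal) :=
      hx.trans_lt (EReal.coe_lt_coe_iff.2 (by linarith))
    have hy' : HypoSym.minkSym u ψ y < ((r + ε / 2 : ℝ) : EReal) :=
      hy.trans_lt (EReal.coe_lt_coe_iff.2 (by linarith))
    obtain ⟨a, b, s, s', h1, h2, rfl, h4⟩ := exists_of_minkSym_lt hψ.ne_bot hu hx'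
    obtain ⟨a', b', v, v', h1', h2', rfl, h4'⟩ := exists_of_minkSym_lt hψ.ne_bot hu hy'
    have k1 := hψ.convex_epi (x := (a, s)) h1.le (y := (a', v)) h1'.le hp hq hpq
    have k2 := hψ.convex_epi (x := (b, s')) h2.le (y := (b', v')) h2'.le hp hq hpq
    have k3 := minkSym_le hu k1 k2
    simp only [Prod.smul_mk, Prod.mk_add_mk, smul_eq_mul, reflect_add, reflect_smul] at k3
    have e : (1 / 2 : ℝ) • (p • a + q • a' + (p • reflect u b + q • reflect u b'))
        = p • (1 / 2 : ℝ) • (a + reflect u b) + q • (1 / 2 : ℝ) • (a' + reflect u b') := by module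
    rw [e] at k3
    refine k3.trans_lt (EReal.coe_lt_coe_iff.2 ?_)
    have : (p * s + q * v + (p * s' + q * v')) / 2 = p * (t + ε / 2) + q * (r + ε / 2) := by
      rw [h4, h4']; ring
    rw [this]
    have : p * (t + ε / 2) + q * (r + ε / 2) = p * t + q * r + (p + q) * (ε / 2) := by ring
    rw [this, hpq]
    linarith
  coercive := by
    rw [EReal.tendsto_nhds_top_iff_real]
    intro t
    filter_upwards [(isCompact_midpointLevel hψ u (t + 1)).compl_mem_cocompact] with x hx
    by_contra! hle
    exact hx (mem_midpointLevel_of_lt hψ.ne_bot hu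
      (hle.trans_lt (EReal.coe_lt_coe_iff.2 (by linarith))))
  ne_bot := by
    obtain ⟨c, hc⟩ := hψ.exists_coe_le
    exact fun x => ne_bot_of_coe_le (coe_le_minkSym hc hu x)
  dom_nonempty := by
    obtain ⟨x, hx⟩ := hψ.dom_nonempty
    have := (EReal.coe_toReal hx (hψ.ne_bot _)).ge
    exact ⟨_, ne_top_of_le_ne_top (EReal.coe_ne_top _) (minkSym_le hu this this)⟩
  lsc := by
    rw [lowerSemicontinuous_iff_isClosed_preimage]
    intro y
    have : HypoSym.minkSym u ψ ⁻¹' Set.Iic y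
        = ⋂ (t : ℝ) (_ : y < t), midpointLevel u ψ t := by
      ext x
      simp only [Set.mem_preimage, Set.mem_Iic, Set.mem_iInter]
      constructor
      · exact fun h t ht => mem_midpointLevel_of_lt hψ.ne_bot hu (h.trans_lt ht)
      · intro h
        by_contra! hlt
        obtain ⟨r, h1, h2⟩ := EReal.lt_iff_exists_real_btwn.1 hlt
        exact absurd h2 (not_lt.2 (minkSym_le_of_mem hu (h r h1)))
    rw [this]
    exact isClosed_iInter fun t => isClosed_iInter fun _ =>
      (isCompact_midpointLevel hψ u t).isClosed

/-! ### The profile relating a function and its base function -/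

/-- The decreasing function `t ↦ (1 - α t)₊ ^ (1 / α)`, or `t ↦ exp (-t)` if `α = 0`, with value
`0` at `∞`. -/
def profile (α : ℝ) (e : EReal) : ℝ :=
  open Classical in
  if e = ⊤ then 0
  else if α = 0 then Real.exp (-e.toReal)
  else (max (1 - α * e.toReal) 0) ^ (1 / α)

theorem ofBase_apply (α : ℝ) (ψ : E n → EReal) (x : E n) : ofBase α ψ x = profile α (ψ x) := rfl

theorem profile_top (α : ℝ) : profile α ⊤ = 0 := by simp [profile]

theorem profile_coe_zero (t : ℝ) : profile 0 (t : EReal) = Real.exp (-t) := by simp [profile]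

theorem profile_coe {α : ℝ} (hα : α ≠ 0) (t : ℝ) :
    profile α (t : EReal) = (max (1 - α * t) 0) ^ (1 / α) := by simp [profile, hα]

theorem profile_nonneg (α : ℝ) (e : EReal) : 0 ≤ profile α e := by
  unfold profile
  split_ifs
  · exact le_rfl
  · positivity
  · exact Real.rpow_nonneg (le_max_right _ _) _

theorem profile_coe_pos {α t : ℝ} (h : 0 < 1 - α * t) : 0 < profile α (t : EReal) := by
  rcases eq_or_ne α 0 with rfl | hα
  · rw [profile_coe_zero]; positivity
  · rw [profile_coe hα, max_eq_left h.le]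
    exact Real.rpow_pos_of_pos h _

theorem profile_rpow {α t : ℝ} (hα : α ≠ 0) (h : 0 ≤ 1 - α * t) :
    profile α (t : EReal) ^ α = 1 - α * t := by
  rw [profile_coe hα, max_eq_left h, ← Real.rpow_mul h, one_div_mul_cancel hα, Real.rpow_one]

theorem one_sub_mul_pos_of_profile_pos {α t : ℝ} (h : 0 < profile α (t : EReal)) :
    0 < 1 - α * t ∨ α < 0 := by
  by_contra! h'
  rcases h'.2.eq_or_lt with rfl | hα
  · norm_num at h'
  · rw [profile_coe hα.ne', max_eq_right h'.1, Real.zero_rpow (one_div_ne_zero hα.ne')] at h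
    exact lt_irrefl _ h

theorem one_sub_mul_pos_of_le {α c t : ℝ} (hα : α ≤ 0) (hc : 0 < 1 - α * c) (h : c ≤ t) :
    0 < 1 - α * t := by
  nlinarith

/-- For `α < 0` monotonicity fails below `1 / α`, where the formula gives `0 ^ (1 / α) = 0`. A lower
bound `c` with `0 < 1 - α c` keeps away from that range, and this is why such a `c` accompanies
every later statement. -/
theorem profile_anti_coe {α c s t : ℝ} (hc : 0 < 1 - α * c) (hs : c ≤ s) (hst : s ≤ t) :
    profile α (t : EReal) ≤ profile α (s : EReal) := by
  rcases lt_trichotomy α 0 with hα | rfl | hα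
  · have h1 := one_sub_mul_pos_of_le hα.le hc hs
    have h2 := one_sub_mul_pos_of_le hα.le hc (hs.trans hst)
    rw [profile_coe hα.ne, profile_coe hα.ne, max_eq_left h1.le, max_eq_left h2.le]
    exact Real.rpow_le_rpow_of_nonpos h1 (by nlinarith) (one_div_nonpos.2 hα.le)
  · rw [profile_coe_zero, profile_coe_zero]
    exact Real.exp_le_exp.2 (by linarith)
  · rw [profile_coe hα.ne', profile_coe hα.ne']
    exact Real.rpow_le_rpow (le_max_right _ _) (max_le_max (by nlinarith) le_rfl)
      (one_div_pos.2 hα).le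

theorem profile_anti {α c : ℝ} (hc : 0 < 1 - α * c) {a b : EReal} (ha : (c : EReal) ≤ a)
    (hab : a ≤ b) : profile α b ≤ profile α a := by
  rcases eq_or_ne b ⊤ with rfl | hb
  · rw [profile_top]; exact profile_nonneg _ _
  · have ha' : a ≠ ⊤ := ne_top_of_le_ne_top hb hab
    have hbb := ne_bot_of_coe_le (ha.trans hab)
    have hab' := ne_bot_of_coe_le ha
    lift a to ℝ using ⟨ha', hab'⟩
    lift b to ℝ using ⟨hb, hbb⟩
    exact profile_anti_coe hc (EReal.coe_le_coe_iff.1 ha) (EReal.coe_le_coe_iff.1 hab)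

/-- Truncation at `c` makes the profile antitone, and by `continuous_profile_max` continuous, on all
of `EReal`, so that it can be composed with semicontinuous functions and with `liminf`. -/
theorem profile_max_antitone {α c : ℝ} (hc : 0 < 1 - α * c) :
    Antitone fun e : EReal => profile α (max e c) := fun _ _ hab =>
  profile_anti hc (le_max_right _ _) (max_le_max hab le_rfl)

theorem tendsto_profile_coe_atTop (α : ℝ) :
    Tendsto (fun t : ℝ => profile α (t : EReal)) atTop (𝓝 0) := by
  rcases lt_trichotomy α 0 with hα | rfl | hα
  · simp_rw [profile_coe hα.ne]
    have h1 : Tendsto (fun t : ℝ => max (1 - α * t) 0) atTop atTop := by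
      refine tendsto_atTop_mono (fun t => le_max_left _ _) ?_
      have : Tendsto (fun t : ℝ => 1 + (-α) * t) atTop atTop :=
        tendsto_atTop_add_const_left _ _ (tendsto_id.const_mul_atTop (by linarith))
      refine this.congr fun t => by ring
    have h2 := (tendsto_rpow_neg_atTop (y := -(1 / α)) (by
      have := one_div_neg.2 hα
      linarith)).comp h1
    simpa [Function.comp_def] using h2
  · simp_rw [profile_coe_zero]
    exact Real.tendsto_exp_neg_atTop_nhds_zero
  · refine tendsto_const_nhds.congr' ?_
    filter_upwards [eventually_ge_atTop (1 / α)] with t ht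
    rw [profile_coe hα.ne', max_eq_right, Real.zero_rpow (one_div_ne_zero hα.ne')]
    have := (div_le_iff₀ hα).1 ht
    linarith

theorem continuous_profile_max {α c : ℝ} (hc : 0 < 1 - α * c) :
    Continuous fun e : EReal => profile α (max e c) := by
  rw [continuous_iff_continuousAt]
  intro e
  rcases eq_or_ne e ⊤ with rfl | he
  · have h0 : profile α (max ⊤ (c : EReal)) = 0 := by rw [max_eq_left le_top, profile_top]
    rw [ContinuousAt, h0]
    refine (nhds_basis_Ioo_pos (0 : ℝ)).tendsto_right_iff.2 fun ε hε => ?_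
    have h1 := (tendsto_profile_coe_atTop α).eventually (gt_mem_nhds hε)
    obtain ⟨t, ht, htc⟩ := (h1.and (eventually_ge_atTop c)).exists
    filter_upwards [lt_mem_nhds (EReal.coe_lt_top t)] with b hb
    have h2 : profile α (max b c) ≤ profile α t :=
      profile_anti hc (EReal.coe_le_coe_iff.2 htc) (hb.le.trans (le_max_left _ _))
    have h3 := profile_nonneg α (max b c)
    constructor <;> linarith
  · have hm : max e (c : EReal) ≠ ⊤ := by simp [max_eq_iff, he]
    have hb : max e (c : EReal) ≠ ⊥ := ne_bot_of_coe_le (le_max_right _ _)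
    have h1 : ContinuousAt (fun e : EReal => (max e (c : EReal)).toReal) e :=
      (EReal.tendsto_toReal hm hb).comp ((continuous_id.max continuous_const).tendsto e)
    have h2 : (fun e : EReal => profile α (max e c)) =ᶠ[𝓝 e]
        fun e => profile α ((max e (c : EReal)).toReal : EReal) := by
      filter_upwards [gt_mem_nhds (lt_top_iff_ne_top.2 he)] with b hb
      rw [EReal.coe_toReal]
      · simp [max_eq_iff, hb.ne]
      · exact ne_bot_of_coe_le (le_max_right _ _)
    refine ContinuousAt.congr ?_ h2.symm
    rcases eq_or_ne α 0 with rfl | hα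
    · simp_rw [profile_coe_zero]
      exact Real.continuous_exp.continuousAt.comp h1.neg
    · simp_rw [profile_coe hα]
      refine ContinuousAt.rpow_const ((continuousAt_const.sub (continuousAt_const.mul h1)).max
        continuousAt_const) ?_
      rcases lt_or_gt_of_ne hα with hα | hα
      · left
        have hcm : c ≤ (max e (c : EReal)).toReal := by
          rw [← EReal.coe_le_coe_iff, EReal.coe_toReal hm hb]
          exact le_max_right _ _
        have := one_sub_mul_pos_of_le hα.le hc hcm
        exact (this.trans_le (le_max_left _ _)).ne'
      · exact Or.inr (one_div_pos.2 hα).le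

/-! ### The class of base functions -/

/-- The functions of `Conv_c(ℝⁿ)` bounded below by `c` that are base functions of elements of
`C_α(ℝⁿ)`, when `0 < 1 - α c`. -/
structure MemBase (α c : ℝ) (ψ : E n → EReal) : Prop where
  conv : MemConvC ψ
  lower : ∀ x, (c : EReal) ≤ ψ x
  upper : 0 < α → ∀ x, ψ x ≠ ⊤ → ψ x ≤ ((1 / α : ℝ) : EReal)
  -- Full dimension of the support, in a quantitative form: `r` and `C` can be kept fixed under
  -- symmetrization and in the limit, while only the centre moves.
  exists_ball : ∃ (x₀ : E n) (r C : ℝ), 0 < r ∧ 0 < 1 - α * C ∧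
    ∀ y ∈ Metric.ball x₀ r, ψ y ≤ (C : EReal)

theorem MemConvC.le_combo {ψ : E n → EReal} (hψ : MemConvC ψ) {x y : E n} {s t p q : ℝ}
    (hx : ψ x ≤ s) (hy : ψ y ≤ t) (hp : 0 ≤ p) (hq : 0 ≤ q) (hpq : p + q = 1) :
    ψ (p • x + q • y) ≤ ((p * s + q * t : ℝ) : EReal) :=
  hψ.convex_epi (x := (x, s)) hx (y := (y, t)) hy hp hq hpq

theorem mean_coe_zero (s t u v : ℝ) : mean ((0 : ℝ) : EReal) s t u v = u ^ s * v ^ t := by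
  simp [mean]

theorem mean_coe {α : ℝ} (hα : α ≠ 0) (s t u v : ℝ) :
    mean (α : EReal) s t u v = (s * u ^ α + t * v ^ α) ^ (1 / α) := by
  simp [mean, hα]

theorem combo_pos {α a b l : ℝ} (ha : 0 < 1 - α * a) (hb : 0 < 1 - α * b)
    (hl : l ∈ Set.Icc (0 : ℝ) 1) : 0 < 1 - α * (l * a + (1 - l) * b) := by
  have h := (convex_Ioi (0 : ℝ)) ha hb hl.1 (sub_nonneg.2 hl.2) (by ring)
  simp only [smul_eq_mul, Set.mem_Ioi] at h
  linarith

/-- The profile carries arithmetic means to `α`-means; this is what makes `α`-concavity of a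
function the convexity of its base function. -/
theorem mean_profile {α a b l : ℝ} (ha : 0 < 1 - α * a) (hb : 0 < 1 - α * b)
    (hl : l ∈ Set.Icc (0 : ℝ) 1) :
    mean (α : EReal) l (1 - l) (profile α (a : EReal)) (profile α (b : EReal))
      = profile α ((l * a + (1 - l) * b : ℝ) : EReal) := by
  rcases eq_or_ne α 0 with rfl | hα
  · rw [mean_coe_zero, profile_coe_zero, profile_coe_zero, profile_coe_zero, ← Real.exp_mul,
      ← Real.exp_mul, ← Real.exp_add]
    congr 1
    ring
  · rw [mean_coe hα, profile_rpow hα ha.le, profile_rpow hα hb.le, profile_coe hα,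
      max_eq_left (combo_pos ha hb hl).le]
    congr 1
    ring

theorem supp_ofBase_eq {α c : ℝ} (hc : 0 < 1 - α * c) {ψ : E n → EReal}
    (hψ : ∀ x, (c : EReal) ≤ ψ x) :
    supp (ofBase α ψ) = {x | ψ x ≠ ⊤ ∧ 0 < 1 - α * (ψ x).toReal} := by
  ext x
  simp only [supp, Set.mem_ofPred_eq, ofBase_apply]
  constructor
  · intro h
    have htop : ψ x ≠ ⊤ := by
      intro h'
      rw [h', profile_top] at h
      exact lt_irrefl _ h
    refine ⟨htop, ?_⟩
    have hcoe := EReal.coe_toReal htop (ne_bot_of_coe_le (hψ x))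
    rw [← hcoe] at h
    rcases one_sub_mul_pos_of_profile_pos h with h | h
    · exact h
    · refine one_sub_mul_pos_of_le h.le hc ?_
      rw [← EReal.coe_le_coe_iff, hcoe]
      exact hψ x
  · rintro ⟨h1, h2⟩
    rw [← EReal.coe_toReal h1 (ne_bot_of_coe_le (hψ x))]
    exact profile_coe_pos h2

theorem ofBase_eq_profile_max {α c : ℝ} {ψ : E n → EReal} (hψ : ∀ x, (c : EReal) ≤ ψ x) :
    ofBase α ψ = fun x => profile α (max (ψ x) c) := by
  funext x
  rw [ofBase_apply, max_eq_left (hψ x)]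

theorem MemBase.ball_subset_supp {α c : ℝ} (hc : 0 < 1 - α * c) {ψ : E n → EReal}
    (hψ : MemBase α c ψ) : ∃ (x₀ : E n) (r : ℝ), 0 < r ∧
      Metric.ball x₀ r ⊆ supp (ofBase α ψ) := by
  obtain ⟨x₀, r, C, hr, hC, h⟩ := hψ.exists_ball
  refine ⟨x₀, r, hr, fun y hy => ?_⟩
  exact (profile_coe_pos hC).trans_le (profile_anti hc (hψ.lower y) (h y hy))

theorem MemBase.memC {α c : ℝ} (hc : 0 < 1 - α * c) {ψ : E n → EReal} (hψ : MemBase α c ψ) :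
    MemC α (ofBase α ψ) := by
  have key : ∀ x ∈ supp (ofBase α ψ), ∀ y ∈ supp (ofBase α ψ), ∀ l ∈ Set.Icc (0 : ℝ) 1,
      mean (α : EReal) l (1 - l) (ofBase α ψ x) (ofBase α ψ y)
        ≤ ofBase α ψ (l • x + (1 - l) • y) ∧ l • x + (1 - l) • y ∈ supp (ofBase α ψ) := by
    intro x hx y hy l hl
    rw [supp_ofBase_eq hc hψ.lower] at hx hy
    obtain ⟨hx1, hx2⟩ := hx
    obtain ⟨hy1, hy2⟩ := hy
    have hxc := EReal.coe_toReal hx1 (hψ.conv.ne_bot x)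
    have hyc := EReal.coe_toReal hy1 (hψ.conv.ne_bot y)
    have h1 := hψ.conv.le_combo hxc.ge hyc.ge hl.1 (sub_nonneg.2 hl.2) (by ring)
    have h2 := profile_anti hc (hψ.lower _) h1
    rw [← mean_profile hx2 hy2 hl, hxc, hyc] at h2
    refine ⟨h2, ?_⟩
    refine lt_of_lt_of_le ?_ (profile_anti hc (hψ.lower _) h1)
    exact profile_coe_pos (combo_pos hx2 hy2 hl)
  obtain ⟨x₀, r, hr, hball⟩ := hψ.ball_subset_supp hc
  refine ⟨fun x => profile_nonneg _ _, ⟨?_, fun x hx y hy l hl => (key x hx y hy l hl).1⟩,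
    ⟨x₀, hball (Metric.mem_ball_self hr)⟩, ?_, ?_, ?_⟩
  · intro x hx y hy a b ha hb hab
    obtain rfl : b = 1 - a := by linarith
    exact (key x hx y hy a ⟨ha, by linarith⟩).2
  · rw [ofBase_eq_profile_max hψ.lower]
    exact (continuous_profile_max hc).comp_lowerSemicontinuous_antitone hψ.conv.lsc
      (profile_max_antitone hc)
  · have h1 : affineSpan ℝ (Metric.ball x₀ r) = ⊤ :=
      Metric.isOpen_ball.affineSpan_eq_top ⟨x₀, Metric.mem_ball_self hr⟩
    exact top_le_iff.1 (h1 ▸ affineSpan_mono ℝ hball)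
  · rw [ofBase_eq_profile_max hψ.lower]
    have h := ((continuous_profile_max hc).tendsto ⊤).comp hψ.conv.coercive
    rw [max_eq_left le_top, profile_top] at h
    exact h

/-- For `α > 0` the base function is finite exactly on the closure of the support, so recovering `ψ`
requires this closure to be the domain of `ψ`; that condition is left as a hypothesis because it is
verified differently in the two applications. -/
theorem base_ofBase {α c : ℝ} (hc : 0 < 1 - α * c) {ψ : E n → EReal}
    (hlow : ∀ x, (c : EReal) ≤ ψ x)
    (hup : 0 < α → ∀ x, ψ x ≠ ⊤ → ψ x ≤ ((1 / α : ℝ) : EReal))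
    (hcl : 0 < α → closure (supp (ofBase α ψ)) = {x | ψ x ≠ ⊤}) :
    base α (ofBase α ψ) = ψ := by
  funext x
  have hxb : ψ x ≠ ⊥ := ne_bot_of_coe_le (hlow x)
  have hf : ofBase α ψ x = profile α (ψ x) := rfl
  unfold base
  split_ifs with hα hx hx h0
  · rw [hcl hα] at hx
    have hup' := hup hα x hx
    rw [hf]
    lift ψ x to ℝ using ⟨hx, hxb⟩ with t
    have ht := EReal.coe_le_coe_iff.1 hup'
    rw [le_div_iff₀ hα] at ht
    rw [profile_rpow hα.ne' (by linarith)]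
    congr 1
    field_simp
    ring
  · rw [hcl hα] at hx
    exact (not_not.1 hx).symm
  · subst h0
    rw [hf] at hx ⊢
    have hxt : ψ x ≠ ⊤ := by
      intro h; rw [h, profile_top] at hx; exact lt_irrefl _ hx
    lift ψ x to ℝ using ⟨hxt, hxb⟩ with t
    rw [profile_coe_zero, Real.log_exp, neg_neg]
  · have hα' : α < 0 := lt_of_le_of_ne (not_lt.1 hα) h0
    have hl := hlow x
    rw [hf] at hx ⊢
    have hxt : ψ x ≠ ⊤ := by
      intro h; rw [h, profile_top] at hx; exact lt_irrefl _ hx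
    lift ψ x to ℝ using ⟨hxt, hxb⟩ with t
    rw [profile_rpow h0 (one_sub_mul_pos_of_le hα'.le hc (EReal.coe_le_coe_iff.1 hl)).le]
    congr 1
    field_simp
    ring
  · by_contra hne
    have hxt : ψ x ≠ ⊤ := Ne.symm hne
    rw [hf] at hx
    have hl := hlow x
    lift ψ x to ℝ using ⟨hxt, hxb⟩ with t
    exact hx (profile_coe_pos
      (one_sub_mul_pos_of_le (not_lt.1 hα) hc (EReal.coe_le_coe_iff.1 hl)))

theorem MemBase.base_ofBase {α c : ℝ} (hc : 0 < 1 - α * c) {ψ : E n → EReal}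
    (hψ : MemBase α c ψ) : base α (ofBase α ψ) = ψ := by
  refine HypoSym.base_ofBase hc hψ.lower hψ.upper fun hα => ?_
  apply subset_antisymm
  · have h1 : supp (ofBase α ψ) ⊆ {x | ψ x ≤ ((1 / α : ℝ) : EReal)} := fun x hx => by
      rw [supp_ofBase_eq hc hψ.lower] at hx
      exact hψ.upper hα x hx.1
    have h2 : IsClosed {x | ψ x ≤ ((1 / α : ℝ) : EReal)} :=
      lowerSemicontinuous_iff_isClosed_preimage.1 hψ.conv.lsc _
    exact fun x hx => ne_top_of_le_ne_top (EReal.coe_ne_top _) (closure_minimal h1 h2 hx)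
  · intro x hx
    obtain ⟨x₀, r, C, hr, hC, h⟩ := hψ.exists_ball
    -- At a domain point `x` the value may be `1 / α`, where the function vanishes, but on the way
    -- to the centre of the ball the bound drops strictly below `1 / α`. Thus `x` is a limit of
    -- points of the support.
    have hseg : openSegment ℝ x x₀ ⊆ supp (ofBase α ψ) := by
      rintro _ ⟨p, q, hp, hq, hpq, rfl⟩
      have h1 := hψ.conv.le_combo (hψ.upper hα x hx) (h x₀ (Metric.mem_ball_self hr)) hp.le hq.le
        hpq
      refine lt_of_lt_of_le (profile_coe_pos ?_) (profile_anti hc (hψ.lower _) h1)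
      have : 1 - α * (p * (1 / α) + q * C) = q * (1 - α * C) := by
        obtain rfl : p = 1 - q := by linarith
        field_simp
        ring
      rw [this]
      positivity
    have h2 := closure_mono hseg
    rw [closure_openSegment] at h2
    exact h2 (left_mem_segment ℝ x x₀)

theorem ofBase_base {α : ℝ} {f : E n → ℝ} (hf : ∀ x, 0 ≤ f x) : ofBase α (base α f) = f := by
  funext x
  rw [ofBase_apply]
  unfold base
  split_ifs with hα hx hx h0
  · rw [profile_coe hα.ne']
    have : 1 - α * ((1 - f x ^ α) / α) = f x ^ α := by field_simp; ring
    rw [this, max_eq_left (Real.rpow_nonneg (hf x) _), ← Real.rpow_mul (hf x),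
      mul_one_div_cancel hα.ne', Real.rpow_one]
  · rw [profile_top]
    by_contra h
    exact hx (subset_closure ((hf x).lt_of_ne h))
  · subst h0
    rw [profile_coe_zero, neg_neg, Real.exp_log hx]
  · rw [profile_coe h0]
    have : 1 - α * ((1 - f x ^ α) / α) = f x ^ α := by field_simp; ring
    rw [this, max_eq_left (Real.rpow_nonneg (hf x) _), ← Real.rpow_mul (hf x),
      mul_one_div_cancel h0, Real.rpow_one]
  · rw [profile_top]
    exact le_antisymm (hf x) (not_lt.1 hx)

/-! ### Base functions of elements of `C_α(ℝⁿ)` -/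

/-- The inverse of `profile α` on `(0, ∞)`. -/
def logit (α s : ℝ) : ℝ :=
  open Classical in if α = 0 then -Real.log s else (1 - s ^ α) / α

theorem logit_zero (s : ℝ) : logit 0 s = -Real.log s := by simp [logit]

theorem logit_of_ne {α : ℝ} (hα : α ≠ 0) (s : ℝ) : logit α s = (1 - s ^ α) / α := by
  simp [logit, hα]

theorem one_sub_mul_logit_pos {α s : ℝ} (hs : 0 < s) : 0 < 1 - α * logit α s := by
  rcases eq_or_ne α 0 with rfl | hα
  · norm_num
  · have : 1 - α * logit α s = s ^ α := by rw [logit_of_ne hα]; field_simp; ring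
    rw [this]
    positivity

theorem profile_logit {α s : ℝ} (hs : 0 < s) : profile α (logit α s : EReal) = s := by
  rcases eq_or_ne α 0 with rfl | hα
  · rw [profile_coe_zero, logit_zero, neg_neg, Real.exp_log hs]
  · have : 1 - α * logit α s = s ^ α := by rw [logit_of_ne hα]; field_simp; ring
    rw [profile_coe hα, this, max_eq_left (by positivity), ← Real.rpow_mul hs.le,
      mul_one_div_cancel hα, Real.rpow_one]

theorem logit_profile {α t : ℝ} (ht : 0 < 1 - α * t) : logit α (profile α (t : EReal)) = t := by
  rcases eq_or_ne α 0 with rfl | hα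
  · rw [profile_coe_zero, logit_zero, Real.log_exp, neg_neg]
  · rw [logit_of_ne hα, profile_rpow hα ht.le]
    field_simp
    ring

theorem logit_anti {α s t : ℝ} (hs : 0 < s) (hst : s ≤ t) : logit α t ≤ logit α s := by
  have ht := hs.trans_le hst
  rcases lt_trichotomy α 0 with hα | rfl | hα
  · rw [logit_of_ne hα.ne, logit_of_ne hα.ne, div_le_div_right_of_neg hα]
    have := Real.rpow_le_rpow_of_nonpos hs hst hα.le
    linarith
  · rw [logit_zero, logit_zero]
    have := Real.log_le_log hs hst
    linarith
  · rw [logit_of_ne hα.ne', logit_of_ne hα.ne']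
    have := Real.rpow_le_rpow hs.le hst hα.le
    exact div_le_div_of_nonneg_right (by linarith) hα.le

theorem logit_mean {α s t l : ℝ} (hs : 0 < s) (ht : 0 < t) (hl : l ∈ Set.Icc (0 : ℝ) 1) :
    0 < mean (α : EReal) l (1 - l) s t ∧
    logit α (mean (α : EReal) l (1 - l) s t) = l * logit α s + (1 - l) * logit α t := by
  have h := mean_profile (one_sub_mul_logit_pos (α := α) hs) (one_sub_mul_logit_pos ht) hl
  rw [profile_logit hs, profile_logit ht] at h
  have hp := combo_pos (one_sub_mul_logit_pos (α := α) hs) (one_sub_mul_logit_pos ht) hl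
  rw [h, logit_profile hp]
  exact ⟨profile_coe_pos hp, rfl⟩

theorem base_of_pos {α : ℝ} {f : E n → ℝ} {x : E n} (hx : 0 < f x) :
    base α f x = (logit α (f x) : EReal) := by
  have hx' : x ∈ closure (supp f) := subset_closure hx
  unfold base logit
  rcases lt_trichotomy α 0 with hα | rfl | hα
  · simp [hα.ne, not_lt.2 hα.le, hx]
  · simp [hx]
  · simp [hα, hα.ne', hx']

theorem base_of_nonpos {α : ℝ} (hα : α ≤ 0) {f : E n → ℝ} {x : E n} (hx : f x ≤ 0) :
    base α f x = ⊤ := by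
  simp [base, not_lt.2 hα, not_lt.2 hx]

theorem base_of_mem_closure {α : ℝ} (hα : 0 < α) {f : E n → ℝ} {x : E n}
    (hx : x ∈ closure (supp f)) : base α f x = (((1 - f x ^ α) / α : ℝ) : EReal) := by
  simp [base, hα, hx]

theorem base_of_notMem_closure {α : ℝ} (hα : 0 < α) {f : E n → ℝ} {x : E n}
    (hx : x ∉ closure (supp f)) : base α f x = ⊤ := by
  simp [base, hα, hx]

theorem base_ne_bot (α : ℝ) (f : E n → ℝ) (x : E n) : base α f x ≠ ⊥ := by
  unfold base
  split_ifs <;> simp only [ne_eq, EReal.coe_ne_bot, not_false_eq_true, top_ne_bot]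

theorem base_combo_of_pos {α : ℝ} {f : E n → ℝ} (hf : MemC α f) {x y : E n} {l : ℝ}
    (hl : l ∈ Set.Icc (0 : ℝ) 1) (hx : 0 < f x) (hy : 0 < f y) :
    0 < f (l • x + (1 - l) • y) ∧
      logit α (f (l • x + (1 - l) • y)) ≤ l * logit α (f x) + (1 - l) * logit α (f y) := by
  have h1 := hf.alphaConcave.2 x hx y hy l hl
  obtain ⟨h2, h3⟩ := logit_mean (α := α) hx hy hl
  exact ⟨h2.trans_le h1, h3 ▸ logit_anti h2 h1⟩

theorem rpow_concave_of_pos {α : ℝ} (hα : 0 < α) {f : E n → ℝ} (hf : MemC α f) {x y : E n} {l : ℝ}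
    (hl : l ∈ Set.Icc (0 : ℝ) 1) (hx : 0 < f x) (hy : 0 < f y) :
    l * f x ^ α + (1 - l) * f y ^ α ≤ f (l • x + (1 - l) • y) ^ α := by
  have h := (base_combo_of_pos hf hl hx hy).2
  rw [logit_of_ne hα.ne', logit_of_ne hα.ne', logit_of_ne hα.ne', div_le_iff₀ hα] at h
  have : (l * ((1 - f x ^ α) / α) + (1 - l) * ((1 - f y ^ α) / α)) * α
      = 1 - (l * f x ^ α + (1 - l) * f y ^ α) := by
    field_simp
    ring
  linarith

theorem le_rpow_iff {α s v : ℝ} (hα : 0 < α) (hs : 0 ≤ s) (hv : 0 ≤ v) :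
    v ≤ s ^ α ↔ v ^ (1 / α) ≤ s := by
  rw [one_div, Real.rpow_inv_le_iff_of_pos hv hs hα]

/-- For `x` in the support the term `l * f x ^ α` may be dropped; what remains is a closed condition
on `x` by upper semicontinuity, so it extends to the closure. Only the case `f x = 0`, in which
nothing was lost, is needed below. -/
theorem rpow_concave_of_mem_closure {α : ℝ} (hα : 0 < α) {f : E n → ℝ} (hf : MemC α f)
    {x y : E n} {l : ℝ} (hl : l ∈ Set.Icc (0 : ℝ) 1) (hx : x ∈ closure (supp f)) (hy : 0 < f y) :
    (1 - l) * f y ^ α ≤ f (l • x + (1 - l) • y) ^ α := by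
  have hv : 0 ≤ (1 - l) * f y ^ α :=
    mul_nonneg (sub_nonneg.2 hl.2) (Real.rpow_nonneg hy.le _)
  have hcl : IsClosed {x | ((1 - l) * f y ^ α) ^ (1 / α) ≤ f (l • x + (1 - l) • y)} :=
    (upperSemicontinuous_iff_isClosed_preimage.1 hf.usc _).preimage
      (f := fun x : E n => l • x + (1 - l) • y) (by fun_prop)
  refine (le_rpow_iff hα (hf.nonneg _) hv).2 (closure_minimal ?_ hcl hx)
  intro z hz
  refine (le_rpow_iff hα (hf.nonneg _) hv).1 (le_trans ?_ (rpow_concave_of_pos hα hf hl hz hy))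
  have := mul_nonneg hl.1 (Real.rpow_nonneg (le_of_lt hz) α)
  linarith

theorem rpow_concave {α : ℝ} (hα : 0 < α) {f : E n → ℝ} (hf : MemC α f)
    {x y : E n} {l : ℝ} (hl : l ∈ Set.Icc (0 : ℝ) 1) (hx : x ∈ closure (supp f))
    (hy : y ∈ closure (supp f)) :
    l * f x ^ α + (1 - l) * f y ^ α ≤ f (l • x + (1 - l) • y) ^ α := by
  rcases (hf.nonneg x).eq_or_lt with hx0 | hx0 <;> rcases (hf.nonneg y).eq_or_lt with hy0 | hy0
  · rw [← hx0, ← hy0, Real.zero_rpow hα.ne']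
    simpa using Real.rpow_nonneg (hf.nonneg _) α
  · rw [← hx0, Real.zero_rpow hα.ne', mul_zero, zero_add]
    exact rpow_concave_of_mem_closure hα hf hl hx hy0
  · rw [← hy0, Real.zero_rpow hα.ne', mul_zero, add_zero]
    have := rpow_concave_of_mem_closure hα hf (l := 1 - l)
      ⟨sub_nonneg.2 hl.2, by linarith [hl.1]⟩ hy hx0
    rwa [sub_sub_cancel, add_comm] at this
  · exact rpow_concave_of_pos hα hf hl hx0 hy0

theorem base_convex {α : ℝ} {f : E n → ℝ} (hf : MemC α f) :
    Convex ℝ {p : E n × ℝ | base α f p.1 ≤ (p.2 : EReal)} := by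
  rintro ⟨x, s⟩ hx ⟨y, t⟩ hy l q hl hq hlq
  obtain rfl : q = 1 - l := by linarith
  have hl' : l ∈ Set.Icc (0 : ℝ) 1 := ⟨hl, by linarith⟩
  simp only [Set.mem_ofPred_eq, Prod.smul_mk, Prod.mk_add_mk, smul_eq_mul] at hx hy ⊢
  rcases le_or_gt α 0 with hα | hα
  · have hx0 : 0 < f x := by
      by_contra! h
      rw [base_of_nonpos hα h, top_le_iff] at hx
      exact EReal.coe_ne_top _ hx
    have hy0 : 0 < f y := by
      by_contra! h
      rw [base_of_nonpos hα h, top_le_iff] at hy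
      exact EReal.coe_ne_top _ hy
    obtain ⟨h1, h2⟩ := base_combo_of_pos hf hl' hx0 hy0
    rw [base_of_pos hx0, EReal.coe_le_coe_iff] at hx
    rw [base_of_pos hy0, EReal.coe_le_coe_iff] at hy
    rw [base_of_pos h1, EReal.coe_le_coe_iff]
    exact h2.trans (add_le_add (mul_le_mul_of_nonneg_left hx hl) (mul_le_mul_of_nonneg_left hy hq))
  · have hx0 : x ∈ closure (supp f) := by
      by_contra h
      rw [base_of_notMem_closure hα h, top_le_iff] at hx
      exact EReal.coe_ne_top _ hx
    have hy0 : y ∈ closure (supp f) := by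
      by_contra h
      rw [base_of_notMem_closure hα h, top_le_iff] at hy
      exact EReal.coe_ne_top _ hy
    have h1 := rpow_concave hα hf hl' hx0 hy0
    rw [base_of_mem_closure hα hx0, EReal.coe_le_coe_iff, div_le_iff₀ hα] at hx
    rw [base_of_mem_closure hα hy0, EReal.coe_le_coe_iff, div_le_iff₀ hα] at hy
    rw [base_of_mem_closure hα (hf.alphaConcave.1.closure hx0 hy0 hl hq hlq),
      EReal.coe_le_coe_iff, div_le_iff₀ hα]
    have h2 := mul_le_mul_of_nonneg_left hx hl
    have h3 := mul_le_mul_of_nonneg_left hy hq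
    linarith

/-- The base function as a function of the value, for `α ≤ 0`. -/
def extLogit (α s : ℝ) : EReal :=
  open Classical in if 0 < s then (logit α s : EReal) else ⊤

theorem base_eq_extLogit {α : ℝ} (hα : α ≤ 0) (f : E n → ℝ) (x : E n) :
    base α f x = extLogit α (f x) := by
  unfold extLogit
  split_ifs with h
  · exact base_of_pos h
  · exact base_of_nonpos hα (not_lt.1 h)

theorem extLogit_antitone (α : ℝ) : Antitone (extLogit α) := by
  intro s t hst
  unfold extLogit
  split_ifs with h1 h2
  · exact EReal.coe_le_coe_iff.2 (logit_anti h2 hst)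
  · exact le_top
  · exact absurd (lt_of_lt_of_le ‹0 < s› hst) h1
  · exact le_rfl

theorem continuous_extLogit {α : ℝ} (hα : α ≤ 0) : Continuous (extLogit α) := by
  rw [continuous_iff_continuousAt]
  intro s
  rcases lt_or_ge 0 s with hs | hs
  · have h1 : extLogit α =ᶠ[𝓝 s] fun s => (logit α s : EReal) := by
      filter_upwards [lt_mem_nhds hs] with t ht
      simp [extLogit, ht]
    refine ContinuousAt.congr ?_ h1.symm
    refine continuous_coe_real_ereal.continuousAt.comp ?_
    rcases eq_or_ne α 0 with rfl | h0
    · refine ContinuousAt.congr (f := fun s => -Real.log s) ?_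
        (Eventually.of_forall fun s => (logit_zero s).symm)
      exact (Real.continuousAt_log hs.ne').neg
    · refine ContinuousAt.congr (f := fun s => (1 - s ^ α) / α) ?_
        (Eventually.of_forall fun s => (logit_of_ne h0 s).symm)
      exact (continuousAt_const.sub (continuousAt_id.rpow_const (Or.inl hs.ne'))).div_const _
  · have h0 : extLogit α s = ⊤ := by simp [extLogit, not_lt.2 hs]
    rw [ContinuousAt, h0, EReal.tendsto_nhds_top_iff_real]
    intro t
    -- The maximum with 0 gives positivity for `α ≤ 0`; the added 1 makes the final comparison with
    -- `t` strict.
    have h1 : 0 < 1 - α * (max t 0 + 1) := by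
      have : 0 ≤ max t 0 := le_max_right _ _
      nlinarith
    have h2 := profile_coe_pos h1
    filter_upwards [gt_mem_nhds (hs.trans_lt h2)] with r hr
    refine lt_of_lt_of_le ?_ (extLogit_antitone α hr.le)
    rw [extLogit, if_pos h2, logit_profile h1, EReal.coe_lt_coe_iff]
    have := le_max_left t 0
    linarith

/-- Concavity of `f ^ α` bounds the support: if `x` in the support were at distance at least `2 R`
from `x₀`, the point of the segment at distance `R` from `x₀` would satisfy `f ^ α ≥ f x₀ ^ α / 2`,
although `f` is already smaller there by its decay at infinity. -/
theorem isCompact_closure_supp {α : ℝ} (hα : 0 < α) {f : E n → ℝ} (hf : MemC α f) :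
    IsCompact (closure (supp f)) := by
  obtain ⟨x₀, hx₀⟩ := hf.proper
  have hx₀' : 0 < f x₀ := hx₀
  have hw : 0 < 1 / 2 * f x₀ ^ α := by positivity
  have hv : 0 < (1 / 2 * f x₀ ^ α) ^ (1 / α) := by positivity
  obtain ⟨K, hK, hKs⟩ := mem_cocompact.1 (hf.tendsto_zero.eventually (gt_mem_nhds hv))
  obtain ⟨R, hR⟩ := (hK.isBounded.subset_ball_lt 0 x₀)
  have hbd : supp f ⊆ Metric.ball x₀ (2 * R) := by
    intro x hx
    by_contra hxb
    rw [Metric.mem_ball, not_lt, dist_eq_norm] at hxb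
    have hd : 0 < ‖x - x₀‖ := by linarith [hR.1]
    set l := R / ‖x - x₀‖ with hl
    have hl0 : 0 ≤ l := div_nonneg hR.1.le hd.le
    have hl2 : l ≤ 1 / 2 := by rw [hl, div_le_iff₀ hd]; linarith
    have h1 := rpow_concave_of_pos hα hf (l := l) ⟨hl0, by linarith⟩ hx hx₀
    have hz : l • x + (1 - l) • x₀ ∉ K := by
      intro hz
      have := hR.2 hz
      have e : l • x + (1 - l) • x₀ - x₀ = l • (x - x₀) := by module
      rw [Metric.mem_ball, dist_eq_norm, e, norm_smul, Real.norm_of_nonneg hl0, hl,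
        div_mul_cancel₀ _ hd.ne'] at this
      exact lt_irrefl _ this
    have h2 : f (l • x + (1 - l) • x₀) < (1 / 2 * f x₀ ^ α) ^ (1 / α) := hKs hz
    refine absurd h2 (not_lt.2 ((le_rpow_iff hα (hf.nonneg _) hw.le).1 (le_trans ?_ h1)))
    have h3 := mul_nonneg hl0 (Real.rpow_nonneg (le_of_lt hx) α)
    have h4 := Real.rpow_nonneg hx₀'.le α
    nlinarith
  exact Metric.isCompact_of_isClosed_isBounded isClosed_closure
    (Metric.isBounded_ball.subset hbd).closure

theorem MemC.memConvC_base {α : ℝ} {f : E n → ℝ} (hf : MemC α f) : MemConvC (base α f) where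
  convex_epi := base_convex hf
  ne_bot := base_ne_bot α f
  dom_nonempty := by
    obtain ⟨x, hx⟩ := hf.proper
    exact ⟨x, by rw [base_of_pos hx]; exact EReal.coe_ne_top _⟩
  coercive := by
    rcases le_or_gt α 0 with hα | hα
    · have h := ((continuous_extLogit hα).tendsto 0).comp hf.tendsto_zero
      have h0 : extLogit α 0 = ⊤ := by simp [extLogit]
      rw [h0] at h
      exact h.congr fun x => (base_eq_extLogit hα f x).symm
    · refine tendsto_const_nhds.congr' ?_
      filter_upwards [(isCompact_closure_supp hα hf).compl_mem_cocompact] with x hx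
      exact (base_of_notMem_closure hα hx).symm
  lsc := by
    rcases le_or_gt α 0 with hα | hα
    · have h := (continuous_extLogit hα).comp_upperSemicontinuous_antitone hf.usc
        (extLogit_antitone α)
      have e : base α f = extLogit α ∘ f := funext fun x => base_eq_extLogit hα f x
      rw [e]
      exact h
    · have hg : LowerSemicontinuous fun x => (((1 - max (f x) 0 ^ α) / α : ℝ) : EReal) := by
        refine Continuous.comp_upperSemicontinuous_antitone
          (g := fun s : ℝ => (((1 - max s 0 ^ α) / α : ℝ) : EReal)) ?_ hf.usc ?_
        · refine continuous_coe_real_ereal.comp ?_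
          exact (continuous_const.sub ((continuous_id.max continuous_const).rpow_const
            fun _ => Or.inr hα.le)).div_const _
        · intro s t hst
          refine EReal.coe_le_coe_iff.2 (div_le_div_of_nonneg_right ?_ hα.le)
          have := Real.rpow_le_rpow (le_max_right s 0) (max_le_max hst le_rfl) hα.le
          linarith
      rw [lowerSemicontinuous_iff_isClosed_preimage] at hg ⊢
      intro y
      rcases eq_or_ne y ⊤ with rfl | hy
      · simp
      · convert (isClosed_closure : IsClosed (closure (supp f))).inter (hg y) using 1
        ext x
        by_cases hx : x ∈ closure (supp f)
        · simp [hx, base_of_mem_closure hα hx, max_eq_left (hf.nonneg x)]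
        · simp [hx, base_of_notMem_closure hα hx, hy]

/-- The support contains an affine basis. On the simplex it spans, the convex base function is at
most its largest vertex value, and this simplex has interior points. -/
theorem MemC.exists_ball {α : ℝ} {f : E n → ℝ} (hf : MemC α f) :
    ∃ (x₀ : E n) (r C : ℝ), 0 < r ∧ 0 < 1 - α * C ∧
      ∀ y ∈ Metric.ball x₀ r, base α f y ≤ (C : EReal) := by
  obtain ⟨s, hs, b, hb⟩ := AffineBasis.exists_affine_subbasis hf.fullDim
  have hfin : s.Finite := finite_set_of_fin_dim_affineIndependent ℝ (hb ▸ b.ind)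
  have hne : s.Nonempty := by
    obtain ⟨i⟩ := b.nonempty
    exact ⟨i, i.2⟩
  obtain ⟨z, hz, hmax⟩ := hfin.exists_maximalFor (fun x => base α f x) s hne
  have hz0 : 0 < f z := hs hz
  have hbz := base_of_pos (α := α) hz0
  have hconv : Convex ℝ {x | base α f x ≤ (logit α (f z) : EReal)} := by
    intro x hx y hy p q hp hq hpq
    have := hf.memConvC_base.le_combo hx hy hp hq hpq
    rwa [← add_mul, hpq, one_mul] at this
  have hsub : convexHull ℝ s ⊆ {x | base α f x ≤ (logit α (f z) : EReal)} := by
    refine convexHull_min (fun x hx => ?_) hconv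
    rw [Set.mem_ofPred_eq, ← hbz]
    rcases le_total (base α f x) (base α f z) with h | h
    · exact h
    · exact hmax hx h
  have hint : (interior (convexHull ℝ s)).Nonempty := by
    rw [interior_convexHull_nonempty_iff_affineSpan_eq_top]
    have := b.tot
    rw [hb] at this
    simpa using this
  obtain ⟨x₀, hx₀⟩ := hint
  obtain ⟨r, hr, hball⟩ := Metric.isOpen_iff.1 isOpen_interior x₀ hx₀
  exact ⟨x₀, r, logit α (f z), hr, one_sub_mul_logit_pos hz0,
    fun y hy => hsub (interior_subset (hball hy))⟩

theorem MemC.exists_memBase {α : ℝ} {f : E n → ℝ} (hf : MemC α f) :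
    ∃ c : ℝ, 0 < 1 - α * c ∧ MemBase α c (base α f) := by
  have hconv := hf.memConvC_base
  obtain ⟨x₀, h, h'⟩ := exists_lower_bound hconv
  have hup : 0 < α → ∀ x, base α f x ≠ ⊤ → base α f x ≤ ((1 / α : ℝ) : EReal) := by
    intro hα x hx
    have hx' : x ∈ closure (supp f) := by
      by_contra hx'
      exact hx (base_of_notMem_closure hα hx')
    rw [base_of_mem_closure hα hx', EReal.coe_le_coe_iff]
    refine div_le_div_of_nonneg_right ?_ hα.le
    have := Real.rpow_nonneg (hf.nonneg x) α
    linarith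
  have hfx : ((base α f x₀).toReal : EReal) = base α f x₀ :=
    EReal.coe_toReal h (hconv.ne_bot _)
  rcases le_or_gt α 0 with hα | hα
  · have hpos : 0 < f x₀ := by
      by_contra! hn
      exact h (base_of_nonpos hα hn)
    have hb := base_of_pos (α := α) hpos
    exact ⟨logit α (f x₀), one_sub_mul_logit_pos hpos, hconv, fun x => hb ▸ h' x, hup,
      hf.exists_ball⟩
  -- For `α > 0` every `c ≤ 0` satisfies `0 < 1 - α c`.
  · refine ⟨min (base α f x₀).toReal 0, ?_, hconv, fun x => ?_, hup, hf.exists_ball⟩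
    · have := min_le_right (base α f x₀).toReal 0
      nlinarith
    · refine le_trans ?_ (h' x)
      rw [← hfx]
      exact EReal.coe_le_coe_iff.2 (min_le_left _ _)

/-! ### Minkowski symmetrization of base functions -/

/-- The point at displacement `v` from the new centre is the midpoint of `x₀ + v` and the reflection
of `x₀ + R_u v`, both summands coming from the old ball; so radius and bound do not change. -/
theorem minkSym_le_on_ball {ψ : E n → EReal} {u : E n} (hu : ‖u‖ = 1) {x₀ : E n} {r C : ℝ}
    (h : ∀ y ∈ Metric.ball x₀ r, ψ y ≤ (C : EReal)) :
    ∀ y ∈ Metric.ball ((1 / 2 : ℝ) • (x₀ + reflect u x₀)) r, minkSym u ψ y ≤ (C : EReal) := by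
  intro y hy
  set v := y - (1 / 2 : ℝ) • (x₀ + reflect u x₀) with hv
  have hvr : ‖v‖ < r := by rwa [Metric.mem_ball, dist_eq_norm] at hy
  have h1 : ψ (x₀ + v) ≤ (C : EReal) := h _ (by simpa [Metric.mem_ball, dist_eq_norm] using hvr)
  have h2 : ψ (x₀ + reflect u v) ≤ (C : EReal) :=
    h _ (by simpa [Metric.mem_ball, dist_eq_norm, norm_reflect hu] using hvr)
  have h3 := minkSym_le hu h1 h2
  rw [reflect_add, reflect_reflect hu] at h3
  have e : (1 / 2 : ℝ) • (x₀ + v + (reflect u x₀ + v)) = y := by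
    rw [hv]
    module
  rw [e] at h3
  simpa using h3

theorem MemBase.minkSym {α c : ℝ} {ψ : E n → EReal} (hψ : MemBase α c ψ) {u : E n}
    (hu : ‖u‖ = 1) : MemBase α c (minkSym u ψ) where
  conv := hψ.conv.minkSym hu
  lower := coe_le_minkSym hψ.lower hu
  upper := by
    intro hα x hx
    obtain ⟨t, ht, -⟩ := EReal.lt_iff_exists_real_btwn.1 (lt_top_iff_ne_top.2 hx)
    obtain ⟨a, b, s, s', h1, h2, rfl, -⟩ := exists_of_minkSym_lt hψ.conv.ne_bot hu ht
    have := minkSym_le hu (hψ.upper hα a h1.ne_top) (hψ.upper hα b h2.ne_top)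
    simpa using this
  exists_ball := by
    obtain ⟨x₀, r, C, hr, hC, h⟩ := hψ.exists_ball
    exact ⟨_, r, C, hr, hC, minkSym_le_on_ball hu h⟩

theorem MemBase.iterSym {α c : ℝ} {ψ : E n → EReal} (hψ : MemBase α c ψ) {u : ℕ → E n}
    (hu : ∀ i, ‖u i‖ = 1) (m : ℕ) : MemBase α c (iterSym u ψ m) := by
  induction m with
  | zero => exact hψ
  | succ m ih => exact ih.minkSym (hu m)

theorem iterSym_le_on_ball {ψ : E n → EReal} {u : ℕ → E n} (hu : ∀ i, ‖u i‖ = 1)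
    {x₀ : E n} {r C : ℝ} (h : ∀ y ∈ Metric.ball x₀ r, ψ y ≤ (C : EReal)) (m : ℕ) :
    ∃ x : E n, ‖x‖ ≤ ‖x₀‖ ∧ ∀ y ∈ Metric.ball x r, iterSym u ψ m y ≤ (C : EReal) := by
  induction m with
  | zero => exact ⟨x₀, le_rfl, h⟩
  | succ m ih =>
    obtain ⟨x, hx, hxb⟩ := ih
    refine ⟨_, ?_, minkSym_le_on_ball (hu m) hxb⟩
    rw [norm_smul]
    have := norm_add_le x (reflect (u m) x)
    rw [norm_reflect (hu m)] at this
    norm_num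
    linarith

/-- The pointwise bounds pass to limits of recovery sequences. For the ball, the moving centres stay
bounded and have a cluster point `x`; a point of the ball about `x` lies in infinitely many of the
moving balls, and the liminf inequality along a constant sequence applies. -/
theorem MemBase.of_epiTendsto {α c : ℝ} {ψ φ : E n → EReal} (hψ : MemBase α c ψ) {u : ℕ → E n}
    (hu : ∀ i, ‖u i‖ = 1) (hφ : MemConvC φ) (h : EpiTendsto (HypoSym.iterSym u ψ) φ) :
    MemBase α c φ where
  conv := hφ
  lower := by
    intro x
    obtain ⟨xs, -, hlim⟩ := (h x).2
    exact ge_of_tendsto' hlim fun m => (hψ.iterSym hu m).lower _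
  upper := by
    intro hα x hx
    obtain ⟨xs, -, hlim⟩ := (h x).2
    refine le_of_tendsto hlim ?_
    filter_upwards [hlim.eventually (gt_mem_nhds (lt_top_iff_ne_top.2 hx))] with m hm
    exact (hψ.iterSym hu m).upper hα _ hm.ne
  exists_ball := by
    obtain ⟨x₀, r, C, hr, hC, hb⟩ := hψ.exists_ball
    choose xs hxs hxb using iterSym_le_on_ball hu hb
    obtain ⟨x, -, k, hk, hlim⟩ := (isCompact_closedBall (0 : E n) ‖x₀‖).tendsto_subseq
      (x := xs) fun m => by simpa using hxs m
    refine ⟨x, r, C, hr, hC, fun y hy => ?_⟩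
    refine ((h y).1 (fun _ => y) tendsto_const_nhds).trans ?_
    refine liminf_le_of_frequently_le ?_
    refine hk.tendsto_atTop.frequently (Eventually.frequently ?_)
    have h1 : ∀ᶠ z in 𝓝 x, y ∈ Metric.ball z r := by
      filter_upwards [Metric.isOpen_ball.mem_nhds (x := x) (by rwa [Metric.mem_ball_comm] at hy)]
        with z hz
      rwa [Metric.mem_ball_comm]
    filter_upwards [hlim.eventually h1] with m hm
    exact hxb _ y hm

/-- The truncated profile is continuous and antitone, so it turns the liminf inequality for base
functions into the limsup inequality for functions and preserves recovery sequences. -/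
theorem HypoTendsto.of_epiTendsto {α c : ℝ} (hc : 0 < 1 - α * c) {ψs : ℕ → E n → EReal}
    {φ : E n → EReal} (hψ : ∀ m x, (c : EReal) ≤ ψs m x) (hφ : ∀ x, (c : EReal) ≤ φ x)
    (h : EpiTendsto ψs φ) : HypoTendsto (fun m => ofBase α (ψs m)) (ofBase α φ) := by
  simp_rw [ofBase_eq_profile_max hφ, fun m => ofBase_eq_profile_max (α := α) (hψ m)]
  intro x
  refine ⟨fun xs hxs => ?_, ?_⟩
  · have hanti : Antitone fun e : EReal => (profile α (max e c) : EReal) := fun a b hab =>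
      EReal.coe_le_coe_iff.2 (profile_max_antitone hc hab)
    have h1 := hanti.map_liminf_of_continuousAt (F := atTop) (fun j => ψs j (xs j))
      (continuous_coe_real_ereal.comp (continuous_profile_max hc)).continuousAt
    have h2 := hanti ((h x).1 xs hxs)
    refine le_trans (le_of_eq ?_) h2
    exact h1.symm
  · obtain ⟨xs, hxs, hlim⟩ := (h x).2
    exact ⟨xs, hxs, ((continuous_profile_max hc).tendsto _).comp hlim⟩

/-! ### Orthogonal transformations and halves -/

theorem MemC.exists_ball_subset_supp {α : ℝ} {f : E n → ℝ} (hf : MemC α f) :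
    ∃ (x₀ : E n) (r : ℝ), 0 < r ∧ Metric.ball x₀ r ⊆ supp f := by
  obtain ⟨c, hc, hb⟩ := hf.exists_memBase
  have := hb.ball_subset_supp hc
  rwa [ofBase_base hf.nonneg] at this

theorem MemC.comp_isometry {α : ℝ} {f : E n → ℝ} (hf : MemC α f) (T : E n ≃ₗᵢ[ℝ] E n) :
    MemC α fun x => f (T x) := by
  have hT : ∀ (x y : E n) (a b : ℝ), T (a • x + b • y) = a • T x + b • T y := fun x y a b => by
    simp
  obtain ⟨x₀, r, hr, hball⟩ := hf.exists_ball_subset_supp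
  have hball' : Metric.ball (T.symm x₀) r ⊆ supp fun x => f (T x) := by
    intro y hy
    refine hball ?_
    rw [Metric.mem_ball] at hy ⊢
    rwa [← T.dist_map, T.apply_symm_apply] at hy
  refine ⟨fun x => hf.nonneg _, ⟨?_, ?_⟩, ⟨_, hball' (Metric.mem_ball_self hr)⟩, ?_, ?_, ?_⟩
  · intro x hx y hy a b ha hb hab
    have := hf.alphaConcave.1 (x := T x) hx (y := T y) hy ha hb hab
    rw [← hT] at this
    exact this
  · intro x hx y hy l hl
    have := hf.alphaConcave.2 (T x) hx (T y) hy l hl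
    rwa [← hT] at this
  · rw [upperSemicontinuous_iff_isClosed_preimage]
    exact fun y => (upperSemicontinuous_iff_isClosed_preimage.1 hf.usc y).preimage T.continuous
  · have h1 : affineSpan ℝ (Metric.ball (T.symm x₀) r) = ⊤ :=
      Metric.isOpen_ball.affineSpan_eq_top ⟨_, Metric.mem_ball_self hr⟩
    exact top_le_iff.1 (h1 ▸ affineSpan_mono ℝ hball')
  · exact hf.tendsto_zero.comp T.toHomeomorph.isClosedEmbedding.tendsto_cocompact

theorem base_comp_isometry (α : ℝ) (f : E n → ℝ) (T : E n ≃ₗᵢ[ℝ] E n) (x : E n) :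
    base α (fun x => f (T x)) x = base α f (T x) := by
  have h : x ∈ closure (supp fun x => f (T x)) ↔ T x ∈ closure (supp f) := by
    have : (supp fun x => f (T x)) = T.toHomeomorph ⁻¹' supp f := rfl
    rw [this, ← T.toHomeomorph.preimage_closure]
    rfl
  unfold base
  by_cases hx : T x ∈ closure (supp f)
  · rw [if_pos hx, if_pos (h.2 hx)]
  · rw [if_neg hx, if_neg (mt h.1 hx)]

/-- Halving lowers the upper bound `1 / α` to `1 / (2 α)`. Hence for `α > 0` the homothety is
positive on its whole domain, which is already closed as the preimage of a sublevel set. The lower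
bound `c / 2` is still admissible. -/
theorem base_homothety_half {α c : ℝ} (hc : 0 < 1 - α * c) {f : E n → ℝ}
    (hf : MemBase α c (base α f)) :
    base α (homothety α (1 / 2) f) = epiMul (1 / 2) (base α f) := by
  set ψ := base α f
  have hc' : 0 < 1 - α * (c / 2) := by linarith
  have hlow : ∀ x, ((c / 2 : ℝ) : EReal) ≤ epiMul (1 / 2) ψ x := by
    intro x
    have h2 : (0 : EReal) ≤ ((1 / 2 : ℝ) : EReal) := by rw [EReal.coe_nonneg]; norm_num
    have := mul_le_mul_of_nonneg_left (hf.lower ((1 / 2 : ℝ)⁻¹ • x)) h2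
    rwa [← EReal.coe_mul, one_div_mul_eq_div] at this
  have htop : ∀ x, epiMul (1 / 2) ψ x ≠ ⊤ → ψ ((1 / 2 : ℝ)⁻¹ • x) ≠ ⊤ := by
    intro x hx h
    refine hx ?_
    rw [epiMul, h, EReal.coe_mul_top_of_pos (by norm_num)]
  have hhalf : 0 < α → ∀ x, epiMul (1 / 2) ψ x ≠ ⊤ →
      epiMul (1 / 2) ψ x ≤ ((1 / (2 * α) : ℝ) : EReal) := by
    intro hα x hx
    rw [epiMul, half_mul_le_iff]
    convert hf.upper hα _ (htop x hx) using 2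
    field_simp
  refine base_ofBase hc' hlow (fun hα x hx => (hhalf hα x hx).trans
    (EReal.coe_le_coe_iff.2 ?_)) fun hα => ?_
  · exact one_div_le_one_div_of_le hα (by linarith)
  · have h1 : supp (ofBase α (epiMul (1 / 2) ψ)) = {x | epiMul (1 / 2) ψ x ≠ ⊤} := by
      rw [supp_ofBase_eq hc' hlow]
      ext x
      simp only [Set.mem_ofPred_eq, and_iff_left_iff_imp]
      intro hx
      have h2 := hhalf hα x hx
      rw [← EReal.coe_toReal hx (ne_bot_of_coe_le (hlow x)), EReal.coe_le_coe_iff] at h2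
      rw [le_div_iff₀ (by positivity)] at h2
      linarith
    have h2 : {x | epiMul (1 / 2) ψ x ≠ ⊤}
        = (fun x : E n => (1 / 2 : ℝ)⁻¹ • x) ⁻¹' (ψ ⁻¹' Set.Iic ((1 / α : ℝ) : EReal)) := by
      ext x
      refine ⟨fun hx => hf.upper hα _ (htop x hx), fun hx => ?_⟩
      have : epiMul (1 / 2) ψ x ≤ ((1 / (2 * α) : ℝ) : EReal) := by
        rw [epiMul, half_mul_le_iff]
        convert (show ψ ((1 / 2 : ℝ)⁻¹ • x) ≤ ((1 / α : ℝ) : EReal) from hx) using 2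
        field_simp
      exact ne_top_of_le_ne_top (EReal.coe_ne_top _) this
    rw [h1, h2]
    refine IsClosed.closure_eq ?_
    exact (lowerSemicontinuous_iff_isClosed_preimage.1 hf.conv.lsc _).preimage
      (continuous_const_smul _)

/-- This makes convexity or concavity of `F`, applied to `f` and `f ∘ R_u` with `λ = 1 / 2`, a
statement about one symmetrization step. -/
theorem asplund_homothety_half {α : ℝ} {f : E n → ℝ} (hf : MemC α f) {u : E n} (hu : ‖u‖ = 1) :
    asplund α (homothety α (1 / 2) f) (homothety α (1 / 2) fun x => f (reflectIso u x))
      = ofBase α (minkSym u (base α f)) := by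
  obtain ⟨c, hc, hb⟩ := hf.exists_memBase
  obtain ⟨c', hc', hb'⟩ := (hf.comp_isometry (reflectIso u)).exists_memBase
  have e : base α (fun x => f (reflectIso u x)) = fun x => base α f (reflect u x) := by
    funext x
    rw [base_comp_isometry, reflectIso_apply hu]
  rw [asplund, base_homothety_half hc hb, base_homothety_half hc' hb', e]
  rfl

/-! ### Monotonicity of functionals -/

theorem mean_half_self (p : EReal) {a : ℝ} (ha : 0 < a) : mean p (1 / 2) (1 / 2) a a = a := by
  unfold mean
  split_ifs with h1 h2 h3
  · exact min_self a
  · exact max_self a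
  · rw [← Real.rpow_add ha]
    norm_num
  · have hp : p.toReal ≠ 0 := EReal.toReal_ne_zero_iff.2 ⟨h3, h2, h1⟩
    rw [← add_mul]
    norm_num
    exact Real.rpow_rpow_inv ha.le hp

theorem le_of_supConvConvex {α : ℝ} {F : (E n → ℝ) → ℝ} (hpos : PosOn α F)
    (hO : OrthInvariant α F) (hF : SupConvConvex α F) {f : E n → ℝ} (hf : MemC α f) {u : E n}
    (hu : ‖u‖ = 1) : F (ofBase α (minkSym u (base α f))) ≤ F f := by
  have h := hF f _ hf (hf.comp_isometry (reflectIso u)) (1 / 2) (by norm_num)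
  rw [show (1 - 1 / 2 : ℝ) = 1 / 2 by norm_num, asplund_homothety_half hf hu, hO f hf,
    mean_half_self _ (hpos f hf)] at h
  exact h

theorem ge_of_supConvConcave {α : ℝ} {F : (E n → ℝ) → ℝ} (hpos : PosOn α F)
    (hO : OrthInvariant α F) (hF : SupConvConcave α F) {f : E n → ℝ} (hf : MemC α f) {u : E n}
    (hu : ‖u‖ = 1) : F f ≤ F (ofBase α (minkSym u (base α f))) := by
  have h := hF f _ hf (hf.comp_isometry (reflectIso u)) (1 / 2) (by norm_num)
  rw [show (1 - 1 / 2 : ℝ) = 1 / 2 by norm_num, asplund_homothety_half hf hu, hO f hf,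
    mean_half_self _ (hpos f hf)] at h
  exact h

theorem iterSym_le_of_supConvConvex {α : ℝ} {F : (E n → ℝ) → ℝ} (hpos : PosOn α F)
    (hO : OrthInvariant α F) (hF : SupConvConvex α F) {f : E n → ℝ} (hf : MemC α f)
    {u : ℕ → E n} (hu : ∀ i, ‖u i‖ = 1) (m : ℕ) :
    F (ofBase α (iterSym u (base α f) m)) ≤ F f := by
  obtain ⟨c, hc, hb⟩ := hf.exists_memBase
  induction m with
  | zero => exact (congrArg F (ofBase_base hf.nonneg)).le
  | succ m ih =>
    have hm := hb.iterSym hu m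
    have h := le_of_supConvConvex hpos hO hF (hm.memC hc) (hu m)
    -- The one-step inequality symmetrizes the base function of the current function; it has to be
    -- identified with the iterate itself.
    rw [hm.base_ofBase hc] at h
    exact h.trans ih

theorem le_iterSym_of_supConvConcave {α : ℝ} {F : (E n → ℝ) → ℝ} (hpos : PosOn α F)
    (hO : OrthInvariant α F) (hF : SupConvConcave α F) {f : E n → ℝ} (hf : MemC α f)
    {u : ℕ → E n} (hu : ∀ i, ‖u i‖ = 1) (m : ℕ) :
    F f ≤ F (ofBase α (iterSym u (base α f) m)) := by
  obtain ⟨c, hc, hb⟩ := hf.exists_memBase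
  induction m with
  | zero => exact (congrArg F (ofBase_base hf.nonneg)).ge
  | succ m ih =>
    have hm := hb.iterSym hu m
    have h := ge_of_supConvConcave hpos hO hF (hm.memC hc) (hu m)
    rw [hm.base_ofBase hc] at h
    exact ih.trans h

theorem IsHypoSymmetrization.memC {α : ℝ} {f g : E n → ℝ} (hf : MemC α f)
    (hg : IsHypoSymmetrization α f g) : MemC α g := by
  obtain ⟨φ, ⟨hφ, -, u, hu, hlim⟩, rfl⟩ := hg
  obtain ⟨c, hc, hb⟩ := hf.exists_memBase
  exact (hb.of_epiTendsto hu hφ hlim).memC hc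

theorem IsHypoSymmetrization.exists_hypoTendsto {α : ℝ} {f g : E n → ℝ} (hf : MemC α f)
    (hg : IsHypoSymmetrization α f g) : ∃ u : ℕ → E n, (∀ i, ‖u i‖ = 1) ∧
      (∀ m, MemC α (ofBase α (iterSym u (base α f) m))) ∧
      HypoTendsto (fun m => ofBase α (iterSym u (base α f) m)) g := by
  obtain ⟨φ, ⟨hφ, -, u, hu, hlim⟩, rfl⟩ := hg
  obtain ⟨c, hc, hb⟩ := hf.exists_memBase
  exact ⟨u, hu, fun m => (hb.iterSym hu m).memC hc,
    HypoTendsto.of_epiTendsto hc (fun m => (hb.iterSym hu m).lower)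
      (hb.of_epiTendsto hu hφ hlim).lower hlim⟩

theorem IsHypoSymmetrization.le {α : ℝ} {F : (E n → ℝ) → ℝ} (hpos : PosOn α F)
    (hlsc : HypoLSC α F) (hO : OrthInvariant α F) (hF : SupConvConvex α F) {f g : E n → ℝ}
    (hf : MemC α f) (hg : IsHypoSymmetrization α f g) : F g ≤ F f := by
  obtain ⟨u, hu, hm, hlim⟩ := hg.exists_hypoTendsto hf
  refine EReal.coe_le_coe_iff.1 ((hlsc _ g hm (hg.memC hf) hlim).trans ?_)
  refine liminf_le_of_frequently_le (Eventually.frequently (Eventually.of_forall fun m => ?_))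
  exact EReal.coe_le_coe_iff.2 (iterSym_le_of_supConvConvex hpos hO hF hf hu m)

theorem IsHypoSymmetrization.ge {α : ℝ} {F : (E n → ℝ) → ℝ} (hpos : PosOn α F)
    (husc : HypoUSC α F) (hO : OrthInvariant α F) (hF : SupConvConcave α F) {f g : E n → ℝ}
    (hf : MemC α f) (hg : IsHypoSymmetrization α f g) : F f ≤ F g := by
  obtain ⟨u, hu, hm, hlim⟩ := hg.exists_hypoTendsto hf
  refine EReal.coe_le_coe_iff.1 (le_trans ?_ (husc _ g hm (hg.memC hf) hlim))
  refine le_limsup_of_frequently_le (Eventually.frequently (Eventually.of_forall fun m => ?_))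
  exact EReal.coe_le_coe_iff.2 (le_iterSym_of_supConvConcave hpos hO hF hf hu m)

/-! ### Successive averages over reflections -/

/-- Unit vectors. -/
abbrev UnitVec (n : ℕ) : Type := {u : E n // ‖u‖ = 1}

/-- The average of a function and its reflection. -/
def avg (h : E n → ℝ) (u : UnitVec n) : E n → ℝ := fun y => (h y + h (reflect u.1 y)) / 2

/-- The points of a set whose reflection is in the set. -/
def symPart (D : Set (E n)) (u : UnitVec n) : Set (E n) := {y | y ∈ D ∧ reflect u.1 y ∈ D}

theorem foldl_avg_induction {P : (E n → ℝ) → Prop} (hP : ∀ h u, P h → P (avg h u))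
    (l : List (UnitVec n)) {h : E n → ℝ} (h0 : P h) : P (l.foldl avg h) := by
  induction l generalizing h with
  | nil => exact h0
  | cons u l ih => exact ih (hP h u h0)

theorem foldl_symPart_induction {P : Set (E n) → Prop} (hP : ∀ D u, P D → P (symPart D u))
    (l : List (UnitVec n)) {D : Set (E n)} (h0 : P D) : P (l.foldl symPart D) := by
  induction l generalizing D with
  | nil => exact h0
  | cons u l ih => exact ih (hP D u h0)

theorem avg_le {h : E n → ℝ} {r M : ℝ} (hM : ∀ y, ‖y‖ = r → h y ≤ M) (u : UnitVec n) :
    ∀ y, ‖y‖ = r → avg h u y ≤ M := by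
  intro y hy
  have h1 := hM y hy
  have h2 := hM (reflect u.1 y) (by rw [norm_reflect u.2, hy])
  unfold avg
  linarith

theorem le_avg {h : E n → ℝ} {r M : ℝ} (hM : ∀ y, ‖y‖ = r → M ≤ h y) (u : UnitVec n) :
    ∀ y, ‖y‖ = r → M ≤ avg h u y := by
  intro y hy
  have h1 := hM y hy
  have h2 := hM (reflect u.1 y) (by rw [norm_reflect u.2, hy])
  unfold avg
  linarith

/-- `h` varies by at most `ε` on pairs of points of the ball of radius `r` at distance less
than `δ`. -/
def HasModulus (r ε δ : ℝ) (h : E n → ℝ) : Prop :=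
  ∀ y y' : E n, ‖y‖ ≤ r → ‖y'‖ ≤ r → ‖y - y'‖ < δ → |h y - h y'| ≤ ε

/-- `h` varies by at most `ε` on every sphere of radius `s ∈ S` about the origin. -/
def HasOsc (S : Set ℝ) (ε : ℝ) (h : E n → ℝ) : Prop :=
  ∀ y y' : E n, ‖y‖ ∈ S → ‖y'‖ = ‖y‖ → |h y - h y'| ≤ ε

theorem abs_avg_sub_avg_le {h : E n → ℝ} {u : UnitVec n} {y y' : E n} {ε : ℝ}
    (h1 : |h y - h y'| ≤ ε) (h2 : |h (reflect u.1 y) - h (reflect u.1 y')| ≤ ε) :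
    |avg h u y - avg h u y'| ≤ ε := by
  unfold avg
  rw [abs_le] at *
  constructor <;> linarith [h1.1, h1.2, h2.1, h2.2]

theorem HasModulus.avg {r ε δ : ℝ} {h : E n → ℝ} (hh : HasModulus r ε δ h) (u : UnitVec n) :
    HasModulus r ε δ (avg h u) := fun y y' hy hy' hyy =>
  abs_avg_sub_avg_le (hh y y' hy hy' hyy)
    (hh _ _ (by rwa [norm_reflect u.2]) (by rwa [norm_reflect u.2])
      (by rwa [norm_reflect_sub u.2]))

theorem HasOsc.avg {S : Set ℝ} {ε : ℝ} {h : E n → ℝ} (hh : HasOsc S ε h) (u : UnitVec n) :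
    HasOsc S ε (avg h u) := fun y y' hy hy' =>
  abs_avg_sub_avg_le (hh y y' hy hy')
    (hh _ _ (by rwa [norm_reflect u.2]) (by rwa [norm_reflect u.2, norm_reflect u.2]))

/-- Finitely many reflections bring every point of a sphere close to every other one. -/
theorem exists_list_reflect_close (r : ℝ) {δ : ℝ} (hδ : 0 < δ) :
    ∃ L : List (UnitVec n), ∀ y z : E n, ‖y‖ = r → ‖z‖ = r →
      ‖y - z‖ < δ ∨ ∃ u ∈ L, ‖reflect u.1 y - z‖ < δ := by
  have hK : IsCompact ((Metric.sphere (0 : E n) r ×ˢ Metric.sphere (0 : E n) r) ∩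
      {p : E n × E n | δ ≤ ‖p.1 - p.2‖}) :=
    ((isCompact_sphere _ _).prod (isCompact_sphere _ _)).inter_right
      (isClosed_le continuous_const (by fun_prop))
  obtain ⟨t, ht⟩ := hK.elim_finite_subcover
    (fun u : UnitVec n => {p : E n × E n | ‖reflect u.1 p.1 - p.2‖ < δ})
    (fun u => isOpen_lt (by have := continuous_reflect u.1; fun_prop) continuous_const) (by
      rintro ⟨y, z⟩ ⟨⟨hy, hz⟩, hyz⟩
      have hy' : ‖y‖ = r := by simpa using hy
      have hz' : ‖z‖ = r := by simpa using hz
      have hyz' : δ ≤ ‖y - z‖ := hyz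
      have hne : y ≠ z := by
        rintro rfl
        rw [sub_self, norm_zero] at hyz'
        linarith
      obtain ⟨u, hu, huy⟩ := exists_reflect_eq (hy'.trans hz'.symm) hne
      refine Set.mem_iUnion.2 ⟨⟨u, hu⟩, ?_⟩
      simpa [huy] using hδ)
  refine ⟨t.toList, fun y z hy hz => ?_⟩
  by_cases hyz : ‖y - z‖ < δ
  · exact Or.inl hyz
  · right
    have hmem : (y, z) ∈ (Metric.sphere (0 : E n) r ×ˢ Metric.sphere (0 : E n) r) ∩
        {p : E n × E n | δ ≤ ‖p.1 - p.2‖} :=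
      ⟨⟨mem_sphere_zero_iff_norm.2 hy, mem_sphere_zero_iff_norm.2 hz⟩, not_lt.1 hyz⟩
    obtain ⟨u, hu⟩ := Set.mem_iUnion.1 (ht hmem)
    obtain ⟨hut, hu⟩ := Set.mem_iUnion.1 hu
    exact ⟨u, Finset.mem_toList.2 hut, hu⟩

/-- A deficit `ε` on a cap is inherited, halved at each average, by every point that lies in the cap
or is sent into it by one reflection of the list. The last average is the outermost one, hence the
induction from the end of the list. -/
theorem foldl_avg_le {h : E n → ℝ} {r M ε δ : ℝ} {z : E n}
    (hM : ∀ y, ‖y‖ = r → h y ≤ M) (hcap : ∀ y, ‖y‖ = r → ‖y - z‖ < δ → h y ≤ M - ε)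
    (l : List (UnitVec n)) : ∀ y, ‖y‖ = r →
      (‖y - z‖ < δ ∨ ∃ u ∈ l, ‖reflect u.1 y - z‖ < δ) →
      l.foldl avg h y ≤ M - ε / 2 ^ l.length := by
  induction l using List.reverseRecOn with
  | nil =>
    intro y hy hyz
    simpa using hcap y hy (by simpa using hyz)
  | append_singleton l u ih =>
    intro y hy hyz
    have hle := foldl_avg_induction (P := fun h => ∀ y, ‖y‖ = r → h y ≤ M)
      (fun h u hh => avg_le hh u) l hM
    have hy' : ‖reflect u.1 y‖ = r := by rw [norm_reflect u.2, hy]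
    rw [List.foldl_append, List.length_append]
    simp only [List.foldl_cons, List.foldl_nil, List.length_singleton, pow_succ]
    have e : ε / (2 ^ l.length * 2) = ε / 2 ^ l.length / 2 := by rw [div_div]
    rw [e, avg]
    have hyz' : (‖y - z‖ < δ ∨ ∃ u ∈ l, ‖reflect u.1 y - z‖ < δ) ∨ ‖reflect u.1 y - z‖ < δ := by
      rcases hyz with h | ⟨v, hv, h⟩
      · exact Or.inl (Or.inl h)
      · rcases List.mem_append.1 hv with hv | hv
        · exact Or.inl (Or.inr ⟨v, hv, h⟩)
        · rw [List.mem_singleton.1 hv] at h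
          exact Or.inr h
    rcases hyz' with h | h
    · linarith [ih y hy h, hle _ hy']
    · linarith [ih _ hy' (Or.inl h), hle _ hy]

/-- If some value is below `M - 2 ε`, the modulus gives a cap where `h ≤ M - ε`, and averaging over
the list `L` lowers the upper bound on the whole sphere by `c`. Since `c` depends only on `ε` and
`L`, and the modulus and the lower bound persist, this can happen only finitely often; `K` counts
the remaining rounds. -/
theorem exists_list_hasOsc_sphere {r s ε δ : ℝ} (hs : s ≤ r) (hε : 0 < ε) (hδ : 0 < δ)
    {h : E n → ℝ} (hh : HasModulus r ε δ h) {B : ℝ} (hB : ∀ y, ‖y‖ ≤ r → |h y| ≤ B) :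
    ∃ l : List (UnitVec n), HasOsc {s} (2 * ε) (l.foldl avg h) := by
  obtain ⟨L, hL⟩ := exists_list_reflect_close (n := n) s hδ
  set c := ε / 2 ^ L.length with hc
  have hc0 : 0 < c := by positivity
  have key : ∀ (K : ℕ) (h : E n → ℝ) (m M : ℝ), HasModulus r ε δ h → (∀ y, ‖y‖ = s → h y ≤ M) →
      (∀ y, ‖y‖ = s → m ≤ h y) → M - m ≤ K * c →
      ∃ l : List (UnitVec n), HasOsc {s} (2 * ε) (l.foldl avg h) := by
    intro K
    induction K with
    | zero =>
      intro h m M _ hM hm hK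
      refine ⟨[], fun y y' hy hy' => ?_⟩
      have hy : ‖y‖ = s := hy
      rw [hy] at hy'
      simp only [Nat.cast_zero, zero_mul] at hK
      rw [List.foldl_nil, abs_le]
      constructor <;> linarith [hM y hy, hm y hy, hM y' hy', hm y' hy']
    | succ K ih =>
      intro h m M hh hM hm hK
      by_cases hz : ∃ z, ‖z‖ = s ∧ h z < M - 2 * ε
      · obtain ⟨z, hz, hzM⟩ := hz
        have hcap : ∀ y, ‖y‖ = s → ‖y - z‖ < δ → h y ≤ M - ε := fun y hy hyz => by
          have := (abs_le.1 (hh y z (hy.le.trans hs) (hz.le.trans hs) hyz)).2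
          linarith
        have h1 := foldl_avg_le hM hcap L
        obtain ⟨l, hl⟩ := ih (L.foldl avg h) m (M - c)
          (foldl_avg_induction (fun _ u hh => hh.avg u) L hh)
          (fun y hy => h1 y hy (hL y z hy hz))
          (foldl_avg_induction (P := fun h => ∀ y, ‖y‖ = s → m ≤ h y) (fun _ u hh => le_avg hh u)
            L hm)
          (by push_cast at hK; linarith)
        exact ⟨L ++ l, by rwa [List.foldl_append]⟩
      · push Not at hz
        refine ⟨[], fun y y' hy hy' => ?_⟩
        have hy : ‖y‖ = s := hy
        rw [hy] at hy'
        rw [List.foldl_nil, abs_le]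
        constructor <;> linarith [hM y hy, hz y hy, hM y' hy', hz y' hy']
  obtain ⟨K, hK⟩ := exists_nat_ge ((B - -B) / c)
  exact key K h (-B) B hh (fun y hy => (abs_le.1 (hB y (hy.le.trans hs))).2)
    (fun y hy => (abs_le.1 (hB y (hy.le.trans hs))).1) ((div_le_iff₀ hc0).1 hK)

theorem abs_avg_le {r B : ℝ} {h : E n → ℝ} (hB : ∀ y, ‖y‖ ≤ r → |h y| ≤ B) (u : UnitVec n) :
    ∀ y, ‖y‖ ≤ r → |avg h u y| ≤ B := by
  intro y hy
  have h1 := abs_le.1 (hB y hy)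
  have h2 := abs_le.1 (hB (reflect u.1 y) (by rwa [norm_reflect u.2]))
  unfold avg
  rw [abs_le]
  constructor <;> linarith [h1.1, h1.2, h2.1, h2.2]

theorem exists_list_hasOsc_finite {r ε δ : ℝ} (hε : 0 < ε) (hδ : 0 < δ)
    {h : E n → ℝ} (hh : HasModulus r ε δ h) {B : ℝ} (hB : ∀ y, ‖y‖ ≤ r → |h y| ≤ B)
    {S : Set ℝ} (hS : S.Finite) (hSr : ∀ s ∈ S, s ≤ r) :
    ∃ l : List (UnitVec n), HasOsc S (2 * ε) (l.foldl avg h) := by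
  induction S, hS using Set.Finite.induction_on with
  | empty => exact ⟨[], fun y y' hy _ => absurd hy (Set.notMem_empty _)⟩
  | @insert s S _ _ ih =>
    obtain ⟨l, hl⟩ := ih fun s' hs' => hSr s' (Set.mem_insert_of_mem _ hs')
    obtain ⟨l', hl'⟩ := exists_list_hasOsc_sphere (hSr s (Set.mem_insert _ _)) hε hδ
      (foldl_avg_induction (fun _ u hh => hh.avg u) l hh)
      (foldl_avg_induction (P := fun h => ∀ y, ‖y‖ ≤ r → |h y| ≤ B) (fun _ u hh => abs_avg_le hh u)
        l hB)
    refine ⟨l ++ l', fun y y' hy hy' => ?_⟩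
    rw [List.foldl_append]
    rcases hy with hy | hy
    · exact hl' y y' hy hy'
    · exact foldl_avg_induction (fun _ u hh => hh.avg u) l' hl y y' hy hy'

/-- Finitely many averages over reflections make a function nearly radial on a ball. -/
theorem exists_list_hasOsc {r ε δ : ℝ} (hε : 0 < ε) (hδ : 0 < δ)
    {h : E n → ℝ} (hh : HasModulus r ε δ h) {B : ℝ} (hB : ∀ y, ‖y‖ ≤ r → |h y| ≤ B) :
    ∃ l : List (UnitVec n), HasOsc (Set.Iic r) (4 * ε) (l.foldl avg h) := by
  obtain ⟨S, hSr, hS, hcov⟩ := (isCompact_Icc (a := (0 : ℝ)) (b := r)).finite_cover_balls hδ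
  obtain ⟨l, hl⟩ := exists_list_hasOsc_finite hε hδ hh hB hS fun s hs => (hSr hs).2
  refine ⟨l, fun y y' hy hy' => ?_⟩
  have hmod := foldl_avg_induction (P := HasModulus r ε δ) (fun _ u hh => hh.avg u) l hh
  have hy : ‖y‖ ≤ r := hy
  rcases eq_or_ne y 0 with rfl | h0
  · rw [norm_zero, norm_eq_zero] at hy'
    rw [hy', sub_self, abs_zero]
    positivity
  have hpos : 0 < ‖y‖ := norm_pos_iff.2 h0
  obtain ⟨s, hs, hys⟩ : ∃ s ∈ S, |‖y‖ - s| < δ := by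
    have := hcov ⟨norm_nonneg y, hy⟩
    simpa [Metric.mem_ball, Real.dist_eq] using this
  have hs0 := (hSr hs).1
  -- Radial rescaling to the nearest radius of the net moves a point by less than `δ`. The two moves
  -- cost `ε` each, on top of `2 ε` on the sphere of the net.
  have hscale : ∀ w : E n, ‖w‖ = ‖y‖ → ‖(s / ‖y‖) • w‖ = s ∧ ‖w - (s / ‖y‖) • w‖ < δ := by
    intro w hw
    constructor
    · rw [norm_smul, hw, Real.norm_of_nonneg (by positivity), div_mul_cancel₀ _ hpos.ne']
    · have e : w - (s / ‖y‖) • w = ((‖y‖ - s) / ‖y‖) • w := by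
        rw [sub_div, div_self hpos.ne']
        module
      rw [e, norm_smul, hw, norm_div, norm_norm, div_mul_cancel₀ _ hpos.ne']
      exact hys
  obtain ⟨a1, a2⟩ := hscale y rfl
  obtain ⟨b1, b2⟩ := hscale y' hy'
  have k1 := abs_le.1 (hmod y _ hy (a1.le.trans (hSr hs).2) a2)
  have k2 := abs_le.1 (hmod y' _ (hy'.le.trans hy) (b1.le.trans (hSr hs).2) b2)
  have k3 := abs_le.1 (hl _ _ (a1.symm ▸ hs) (b1.trans a1.symm))
  rw [abs_le]
  constructor <;> linarith [k1.1, k1.2, k2.1, k2.2, k3.1, k3.2]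

/-- Finitely many reflections cut a star-shaped set that misses a neighbourhood of `z` down to
the ball of radius `‖z‖`. -/
theorem exists_list_subset_closedBall {D : Set (E n)}
    (hstar : ∀ y ∈ D, ∀ t ∈ Set.Icc (0 : ℝ) 1, t • y ∈ D) {z : E n} {δ : ℝ} (hδ : 0 < δ)
    (hz : ∀ y, ‖y - z‖ < δ → y ∉ D) :
    ∃ l : List (UnitVec n), l.foldl symPart D ⊆ Metric.closedBall 0 ‖z‖ := by
  obtain ⟨L, hL⟩ := exists_list_reflect_close (n := n) ‖z‖ hδ
  have hmiss : ∀ l : List (UnitVec n), ∀ y,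
      (‖y - z‖ < δ ∨ ∃ u ∈ l, ‖reflect u.1 y - z‖ < δ) → y ∉ l.foldl symPart D := by
    intro l
    induction l using List.reverseRecOn with
    | nil =>
      intro y hy
      exact hz y (by simpa using hy)
    | append_singleton l u ih =>
      intro y hy hyD
      rw [List.foldl_append] at hyD
      obtain ⟨h1, h2⟩ := hyD
      rcases hy with h | ⟨v, hv, h⟩
      · exact ih y (Or.inl h) h1
      · rcases List.mem_append.1 hv with hv | hv
        · exact ih y (Or.inr ⟨v, hv, h⟩) h1
        · rw [List.mem_singleton.1 hv] at h
          exact ih _ (Or.inl h) h2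
  refine ⟨L, fun y hy => ?_⟩
  have hstar' := foldl_symPart_induction
    (P := fun D => ∀ y ∈ D, ∀ t ∈ Set.Icc (0 : ℝ) 1, t • y ∈ D)
    (fun D u hD y hy t ht => ⟨hD y hy.1 t ht, by rw [reflect_smul]; exact hD _ hy.2 t ht⟩) L hstar
  by_contra hlt
  rw [mem_closedBall_zero_iff, not_le] at hlt
  have hpos : 0 < ‖y‖ := (norm_nonneg z).trans_lt hlt
  have h1 := hstar' y hy (‖z‖ / ‖y‖) ⟨by positivity, (div_le_one hpos).2 hlt.le⟩
  refine hmiss L _ (hL _ z ?_ rfl) h1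
  rw [norm_smul, norm_div, norm_norm, norm_norm, div_mul_cancel₀ _ hpos.ne']

/-! ### Meeting countably many requirements -/

/-- If each of countably many stable properties can be reached by finitely many steps from
everywhere, then a single sequence of steps reaches all of them. -/
theorem exists_seq_forall_eventually {X U : Type*} [Nonempty U] (op : X → U → X) (x₀ : X)
    (T : ℕ → X → Prop) (hstab : ∀ j x u, T j x → T j (op x u))
    (hreach : ∀ (l : List U) (j : ℕ), ∃ l' : List U, T j ((l ++ l').foldl op x₀)) :
    ∃ u : ℕ → U, ∀ x : ℕ → X, x 0 = x₀ → (∀ m, x (m + 1) = op (x m) (u m)) →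
      ∀ j, ∃ m₀, ∀ m ≥ m₀, T j (x m) := by
  obtain ⟨u₀⟩ := ‹Nonempty U›
  choose ext hext using hreach
  let L : ℕ → List U := fun j => Nat.rec [] (fun j l => l ++ ext l j ++ [u₀]) j
  have hLs : ∀ j, L (j + 1) = L j ++ ext (L j) j ++ [u₀] := fun j => rfl
  have hlen : ∀ j, j ≤ (L j).length := by
    intro j
    induction j with
    | zero => exact Nat.zero_le _
    | succ j ih => rw [hLs]; simp only [List.length_append, List.length_singleton]; omega
  have hpre : ∀ i j, i ≤ j → L i <+: L j := by
    intro i j hij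
    induction j, hij using Nat.le_induction with
    | base => exact List.prefix_rfl
    | succ j _ ih =>
      refine ih.trans ?_
      rw [hLs, List.append_assoc]
      exact List.prefix_append _ _
  have hT : ∀ j, T j ((L (j + 1)).foldl op x₀) := by
    intro j
    rw [hLs, List.foldl_append]
    exact hstab _ _ _ (hext (L j) j)
  have hget : ∀ i j m, m < (L i).length → m < (L j).length → (L i)[m]? = (L j)[m]? := by
    intro i j m hi hj
    rcases le_total i j with hij | hij
    · obtain ⟨t, ht⟩ := hpre i j hij
      rw [← ht, List.getElem?_append_left hi]
    · obtain ⟨t, ht⟩ := hpre j i hij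
      rw [← ht, List.getElem?_append_left hj]
  -- `L (m + 1)` has more than `m` entries, so the default `u₀` of `getD` is never taken.
  refine ⟨fun m => ((L (m + 1))[m]?).getD u₀, fun x hx0 hx j => ?_⟩
  have hxm : ∀ j m, m ≤ (L j).length → x m = ((L j).take m).foldl op x₀ := by
    intro j m
    induction m with
    | zero => intro _; simpa using hx0
    | succ m ih =>
      intro hm
      have hm' : m < (L j).length := hm
      rw [hx, ih hm'.le]
      beta_reduce
      rw [hget (m + 1) j m (hlen (m + 1)) hm', List.take_add_one, List.foldl_append,
        List.getElem?_eq_getElem hm']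
      simp
  refine ⟨(L (j + 1)).length, fun m hm => ?_⟩
  induction m, hm using Nat.le_induction with
  | base =>
    rw [hxm (j + 1) _ le_rfl, List.take_length]
    exact hT j
  | succ m _ ih =>
    rw [hx]
    exact hstab _ _ _ ih

/-! ### The convex conjugate -/

/-- The numbers `⟨x, y⟩ - t` with `ψ x < t`; their supremum is the convex conjugate of `ψ`
at `y`. -/
def slopes (ψ : E n → EReal) (y : E n) : Set ℝ :=
  {w | ∃ (x : E n) (t : ℝ), ψ x < t ∧ w = inner ℝ x y - t}

/-- The domain of the convex conjugate. -/
def conjDom (ψ : E n → EReal) : Set (E n) := {y | BddAbove (slopes ψ y)}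

/-- The convex conjugate, on its domain. -/
def conj (ψ : E n → EReal) (y : E n) : ℝ := sSup (slopes ψ y)

theorem slopes_nonempty {ψ : E n → EReal} (hψ : ∃ x, ψ x ≠ ⊤) (y : E n) :
    (slopes ψ y).Nonempty := by
  obtain ⟨x, hx⟩ := hψ
  obtain ⟨t, ht, -⟩ := EReal.lt_iff_exists_real_btwn.1 (lt_top_iff_ne_top.2 hx)
  exact ⟨_, x, t, ht, rfl⟩

/-- Conjugation turns infimal convolution into addition. Working with sets of slopes instead of
suprema covers points outside the domain of the conjugate as well. -/
theorem slopes_minkSym {ψ : E n → EReal} (hψ : ∀ x, ψ x ≠ ⊥) {u : E n} (hu : ‖u‖ = 1) (y : E n) :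
    slopes (minkSym u ψ) y =
      {w | ∃ a ∈ slopes ψ y, ∃ b ∈ slopes ψ (reflect u y), w = (a + b) / 2} := by
  ext w
  constructor
  · rintro ⟨x, t, hx, rfl⟩
    obtain ⟨a, b, s, s', ha, hb, rfl, rfl⟩ := exists_of_minkSym_lt hψ hu hx
    refine ⟨_, ⟨a, s, ha, rfl⟩, _, ⟨b, s', hb, rfl⟩, ?_⟩
    rw [inner_smul_left, inner_add_left, inner_reflect_left, RCLike.conj_to_real]
    ring
  · rintro ⟨_, ⟨a, s, ha, rfl⟩, _, ⟨b, s', hb, rfl⟩, rfl⟩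
    obtain ⟨s₀, h1, h2⟩ := EReal.lt_iff_exists_real_btwn.1 ha
    refine ⟨(1 / 2 : ℝ) • (a + reflect u b), (s + s') / 2, ?_, ?_⟩
    · refine (minkSym_le hu h1.le hb.le).trans_lt (EReal.coe_lt_coe_iff.2 ?_)
      have := EReal.coe_lt_coe_iff.1 h2
      linarith
    · rw [inner_smul_left, inner_add_left, inner_reflect_left, RCLike.conj_to_real]
      ring

theorem mem_conjDom_of_minkSym {ψ : E n → EReal} (hψ : MemConvC ψ) {u : E n} (hu : ‖u‖ = 1)
    {y : E n} (hy : y ∈ conjDom (minkSym u ψ)) : y ∈ conjDom ψ ∧ reflect u y ∈ conjDom ψ := by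
  obtain ⟨M, hM⟩ := hy
  rw [slopes_minkSym hψ.ne_bot hu] at hM
  obtain ⟨a₀, ha₀⟩ := slopes_nonempty hψ.dom_nonempty y
  obtain ⟨b₀, hb₀⟩ := slopes_nonempty hψ.dom_nonempty (reflect u y)
  refine ⟨⟨2 * M - b₀, fun a ha => ?_⟩, ⟨2 * M - a₀, fun b hb => ?_⟩⟩
  · have := hM ⟨a, ha, b₀, hb₀, rfl⟩
    linarith
  · have := hM ⟨a₀, ha₀, b, hb, rfl⟩
    linarith

theorem isLUB_conj {ψ : E n → EReal} (hψ : MemConvC ψ) {y : E n} (hy : y ∈ conjDom ψ) :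
    IsLUB (slopes ψ y) (conj ψ y) :=
  isLUB_csSup (slopes_nonempty hψ.dom_nonempty y) hy

theorem conj_minkSym {ψ : E n → EReal} (hψ : MemConvC ψ) {u : E n} (hu : ‖u‖ = 1)
    {y : E n} (hy : y ∈ conjDom ψ) (hy' : reflect u y ∈ conjDom ψ) :
    y ∈ conjDom (minkSym u ψ) ∧
      conj (minkSym u ψ) y = (conj ψ y + conj ψ (reflect u y)) / 2 := by
  have h1 := isLUB_conj hψ hy
  have h2 := isLUB_conj hψ hy'
  have h3 : IsLUB (slopes (minkSym u ψ) y) ((conj ψ y + conj ψ (reflect u y)) / 2) := by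
    rw [slopes_minkSym hψ.ne_bot hu]
    constructor
    · rintro _ ⟨a, ha, b, hb, rfl⟩
      have := h1.1 ha
      have := h2.1 hb
      linarith
    · intro M hM
      have h4 : conj ψ y ≤ 2 * M - conj ψ (reflect u y) := by
        refine h1.2 fun a ha => ?_
        have : conj ψ (reflect u y) ≤ 2 * M - a := h2.2 fun b hb => by
          have := hM ⟨a, ha, b, hb, rfl⟩
          linarith
        linarith
      linarith
  exact ⟨⟨_, h3.1⟩, h3.csSup_eq (slopes_nonempty (hψ.minkSym hu).dom_nonempty y)⟩

theorem inner_sub_conj_le {ψ : E n → EReal} (hψ : MemConvC ψ) {y : E n} (hy : y ∈ conjDom ψ)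
    (x : E n) : ((inner ℝ x y - conj ψ y : ℝ) : EReal) ≤ ψ x := by
  by_contra! hlt
  obtain ⟨t, h1, h2⟩ := EReal.lt_iff_exists_real_btwn.1 hlt
  have h3 := (isLUB_conj hψ hy).1 ⟨x, t, h1, rfl⟩
  have h4 := EReal.coe_lt_coe_iff.1 h2
  linarith

theorem conj_combo {ψ : E n → EReal} (hψ : MemConvC ψ) {y z : E n} (hy : y ∈ conjDom ψ)
    (hz : z ∈ conjDom ψ) {p q : ℝ} (hp : 0 ≤ p) (hq : 0 ≤ q) (hpq : p + q = 1) :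
    p • y + q • z ∈ conjDom ψ ∧ conj ψ (p • y + q • z) ≤ p * conj ψ y + q * conj ψ z := by
  have h : p * conj ψ y + q * conj ψ z ∈ upperBounds (slopes ψ (p • y + q • z)) := by
    rintro _ ⟨x, t, hx, rfl⟩
    have h1 := mul_le_mul_of_nonneg_left ((isLUB_conj hψ hy).1 ⟨x, t, hx, rfl⟩) hp
    have h2 := mul_le_mul_of_nonneg_left ((isLUB_conj hψ hz).1 ⟨x, t, hx, rfl⟩) hq
    rw [inner_add_right, inner_smul_right, inner_smul_right]
    have : t = p * t + q * t := by rw [← add_mul, hpq, one_mul]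
    linarith
  exact ⟨⟨_, h⟩, (isLUB_conj hψ ⟨_, h⟩).2 h⟩

/-- Outside a ball of radius `R` about a minimizer the function exceeds its minimum by more than 1;
by convexity along rays it then grows at rate at least `1 / R`. -/
theorem exists_linear_growth {ψ : E n → EReal} (hψ : MemConvC ψ) :
    ∃ a d : ℝ, 0 < a ∧ ∀ x, ((a * ‖x‖ - d : ℝ) : EReal) ≤ ψ x := by
  obtain ⟨x₀, hx₀, hmin⟩ := exists_lower_bound hψ
  have hv := EReal.coe_toReal hx₀ (hψ.ne_bot x₀)
  set v := (ψ x₀).toReal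
  obtain ⟨R, hR⟩ := (isCompact_sublevel hψ (v + 1)).isBounded.subset_ball_lt 0 x₀
  have hR0 : 0 < R := hR.1
  have hfar : ∀ x, R ≤ ‖x - x₀‖ → ((v + ‖x - x₀‖ / R : ℝ) : EReal) ≤ ψ x := by
    intro x hx
    by_contra! hlt
    obtain ⟨t, h1, h2⟩ := EReal.lt_iff_exists_real_btwn.1 hlt
    have h2 := EReal.coe_lt_coe_iff.1 h2
    have hd : 0 < ‖x - x₀‖ := hR0.trans_le hx
    have hl0 : 0 ≤ R / ‖x - x₀‖ := by positivity
    have hl1 : R / ‖x - x₀‖ ≤ 1 := (div_le_one hd).2 hx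
    have h3 := hψ.le_combo h1.le hv.ge hl0 (sub_nonneg.2 hl1) (by ring)
    have h4 : (R / ‖x - x₀‖) * t + (1 - R / ‖x - x₀‖) * v ≤ v + 1 := by
      have h5 := mul_le_mul_of_nonneg_left h2.le hl0
      have h6 : R / ‖x - x₀‖ * (v + ‖x - x₀‖ / R) = R / ‖x - x₀‖ * v + 1 := by field_simp
      linarith
    have h5 := hR.2 (h3.trans (EReal.coe_le_coe_iff.2 h4))
    rw [Metric.mem_ball, dist_eq_norm] at h5
    have e : (R / ‖x - x₀‖) • x + (1 - R / ‖x - x₀‖) • x₀ - x₀ = (R / ‖x - x₀‖) • (x - x₀) := by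
      module
    rw [e, norm_smul, Real.norm_of_nonneg hl0, div_mul_cancel₀ _ hd.ne'] at h5
    exact lt_irrefl _ h5
  refine ⟨1 / R, ‖x₀‖ / R + 1 - v, by positivity, fun x => ?_⟩
  have hn : ‖x‖ / R ≤ ‖x - x₀‖ / R + ‖x₀‖ / R := by
    rw [← add_div]
    refine div_le_div_of_nonneg_right ?_ hR0.le
    simpa using norm_add_le (x - x₀) x₀
  rw [one_div_mul_eq_div]
  rcases le_or_gt R ‖x - x₀‖ with h | h
  · exact (EReal.coe_le_coe_iff.2 (by linarith)).trans (hfar x h)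
  · refine le_trans ?_ (hmin x)
    rw [← hv, EReal.coe_le_coe_iff]
    have : ‖x - x₀‖ / R ≤ 1 := (div_le_one hR0).2 h.le
    linarith

theorem exists_ball_subset_conjDom {ψ : E n → EReal} (hψ : MemConvC ψ) :
    ∃ a : ℝ, 0 < a ∧ ∀ y : E n, ‖y‖ ≤ a → y ∈ conjDom ψ := by
  obtain ⟨a, d, ha, h⟩ := exists_linear_growth hψ
  refine ⟨a, ha, fun y hy => ⟨d, ?_⟩⟩
  rintro _ ⟨x, t, hx, rfl⟩
  have h1 := EReal.coe_lt_coe_iff.1 ((h x).trans_lt hx)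
  have h2 := real_inner_le_norm x y
  have h3 := mul_le_mul_of_nonneg_left hy (norm_nonneg x)
  linarith

theorem exists_eq_inner_add_mul (f : StrongDual ℝ (E n × ℝ)) :
    ∃ (v : E n) (κ : ℝ), ∀ z s, f (z, s) = inner ℝ z v + κ * s := by
  refine ⟨(InnerProductSpace.toDual ℝ (E n)).symm (f.comp (ContinuousLinearMap.inl ℝ (E n) ℝ)),
    f (0, 1), fun z s => ?_⟩
  have e : ((z, s) : E n × ℝ) = (z, 0) + s • ((0, 1) : E n × ℝ) := by simp
  rw [e, map_add, map_smul, smul_eq_mul, mul_comm s, real_inner_comm,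
    InnerProductSpace.toDual_symm_apply]
  rfl

/-- Hahn–Banach separates the open cylinder below height `t` over the ball from the epigraph. The
factor `3 / 4` is room to spare: it keeps the test point in direction `v` inside the open ball. That
`κ ≥ 0` follows because the epigraph is unbounded upwards. -/
theorem exists_hyperplane {ψ : E n → EReal} (hψ : MemConvC ψ) {x : E n} {δ t : ℝ} (hδ : 0 < δ)
    (h : ∀ x', ‖x' - x‖ < δ → (t : EReal) ≤ ψ x') :
    ∃ (v : E n) (κ : ℝ), 0 ≤ κ ∧ (κ = 0 → v ≠ 0) ∧ ∀ z (s : ℝ), ψ z < s →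
      inner ℝ x v + 3 / 4 * δ * ‖v‖ + κ * t ≤ inner ℝ z v + κ * s := by
  set A : Set (E n × ℝ) := Metric.ball x δ ×ˢ Set.Iio t
  have hAc : Convex ℝ A := (convex_ball x δ).prod (convex_Iio t)
  have hAo : IsOpen A := Metric.isOpen_ball.prod isOpen_Iio
  have hdisj : Disjoint A {p : E n × ℝ | ψ p.1 ≤ (p.2 : EReal)} := by
    rw [Set.disjoint_left]
    rintro ⟨z, s⟩ ⟨hz, hs⟩ hzs
    rw [Metric.mem_ball, dist_eq_norm] at hz
    have := EReal.coe_le_coe_iff.1 ((h z hz).trans hzs)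
    exact absurd hs (not_lt.2 this)
  obtain ⟨f, c, hA, hB⟩ := geometric_hahn_banach_open hAc hAo hψ.convex_epi hdisj
  obtain ⟨v, κ, hf⟩ := exists_eq_inner_add_mul f
  have hB' : ∀ z (s : ℝ), ψ z < s → c ≤ inner ℝ z v + κ * s := fun z s hz => by
    rw [← hf]
    exact hB (z, s) hz.le
  obtain ⟨x₁, hx₁⟩ := hψ.dom_nonempty
  obtain ⟨s₁, hs₁, -⟩ := EReal.lt_iff_exists_real_btwn.1 (lt_top_iff_ne_top.2 hx₁)
  have hκ0 : 0 ≤ κ := by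
    by_contra! hneg
    have h1 := hB' x₁ (s₁ + (|inner ℝ x₁ v + κ * s₁ - c| + 1) / (-κ)) (hs₁.trans_le
      (EReal.coe_le_coe_iff.2 (by
        have : 0 ≤ (|inner ℝ x₁ v + κ * s₁ - c| + 1) / (-κ) := by
          have : 0 < -κ := by linarith
          positivity
        linarith)))
    have h2 : κ * ((|inner ℝ x₁ v + κ * s₁ - c| + 1) / (-κ))
        = -(|inner ℝ x₁ v + κ * s₁ - c| + 1) := by
      rw [mul_div_assoc', div_eq_iff (by linarith)]
      ring
    have h3 := le_abs_self (inner ℝ x₁ v + κ * s₁ - c)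
    rw [mul_add, h2] at h1
    linarith
  have hA' : inner ℝ x v + 3 / 4 * δ * ‖v‖ + κ * t ≤ c := by
    have hmem : x + (3 / 4 * δ / ‖v‖) • v ∈ Metric.ball x δ := by
      rw [Metric.mem_ball, dist_eq_norm, add_sub_cancel_left, norm_smul,
        Real.norm_of_nonneg (by positivity)]
      rcases (norm_nonneg v).eq_or_lt with h | h
      · rw [← h, mul_zero]; exact hδ
      · rw [div_mul_cancel₀ _ h.ne']; linarith
    have hin : inner ℝ (x + (3 / 4 * δ / ‖v‖) • v) v = inner ℝ x v + 3 / 4 * δ * ‖v‖ := by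
      rw [inner_add_left, inner_smul_left, RCLike.conj_to_real, real_inner_self_eq_norm_sq]
      rcases (norm_nonneg v).eq_or_lt with h | h
      · rw [← h]; simp
      · field_simp
    have hlim : ∀ ε > 0, inner ℝ x v + 3 / 4 * δ * ‖v‖ + κ * t ≤ c + ε := by
      intro ε hε
      have h1 := hA (x + (3 / 4 * δ / ‖v‖) • v, t - ε / (κ + 1))
        (Set.mk_mem_prod hmem (Set.mem_Iio.2 (sub_lt_self t (by positivity))))
      rw [hf, hin] at h1
      have h2 : κ * (ε / (κ + 1)) ≤ ε := by
        rw [mul_div_assoc', div_le_iff₀ (by positivity)]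
        nlinarith
      rw [mul_sub] at h1
      linarith
    exact le_of_forall_pos_le_add hlim
  refine ⟨v, κ, hκ0, fun hz hv0 => ?_, fun z s hz => hA'.trans (hB' z s hz)⟩
  have h1 := hA (x, t - 1)
    (Set.mk_mem_prod (Metric.mem_ball_self hδ) (Set.mem_Iio.2 (sub_one_lt t)))
  have h2 := hB' x₁ s₁ hs₁
  rw [hf] at h1
  rw [hv0, hz] at h1 h2
  simp only [inner_zero_right, zero_mul, add_zero] at h1 h2
  linarith

/-- Separation: if `ψ ≥ t` on a ball about `x`, then some affine minorant of `ψ` shows that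
`ψ ≥ t` on the ball of half the radius. -/
theorem exists_conj_add_le {ψ : E n → EReal} (hψ : MemConvC ψ) {x : E n} {δ t : ℝ} (hδ : 0 < δ)
    (h : ∀ x', ‖x' - x‖ < δ → (t : EReal) ≤ ψ x') :
    ∃ y ∈ conjDom ψ, conj ψ y + δ / 2 * ‖y‖ ≤ inner ℝ x y - t := by
  obtain ⟨a, ha, hD⟩ := exists_ball_subset_conjDom hψ
  have h0 : (0 : E n) ∈ conjDom ψ := hD 0 (by simpa using ha.le)
  obtain ⟨v, κ, hκ0, hvκ, hsep⟩ := exists_hyperplane hψ hδ h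
  rcases hκ0.eq_or_lt with hz | hpos
  · have hv0 : 0 < ‖v‖ := norm_pos_iff.2 (hvκ hz.symm)
    -- The hyperplane is vertical, so the constant minorant `-conj ψ 0` is tilted by a multiple of
    -- `v`. With this `N` the surplus `(3 / 4 - 1 / 2) * δ * N * ‖v‖` absorbs `conj ψ 0 + t`.
    set N := |conj ψ 0 + t| / (1 / 4 * δ * ‖v‖) with hN
    have hN0 : 0 ≤ N := by positivity
    have hNe : N * (1 / 4 * δ * ‖v‖) = |conj ψ 0 + t| := div_mul_cancel₀ _ (by positivity)
    have hub : inner ℝ x (-(N • v)) - 3 / 4 * δ * (N * ‖v‖) + conj ψ 0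
        ∈ upperBounds (slopes ψ (-(N • v))) := by
      rintro _ ⟨b, s, hb, rfl⟩
      have h1 := (isLUB_conj hψ h0).1 ⟨b, s, hb, rfl⟩
      have h2 := hsep b s hb
      rw [← hz] at h2
      simp only [zero_mul, add_zero] at h2
      have h3 := mul_le_mul_of_nonneg_left h2 hN0
      rw [inner_zero_right] at h1
      rw [inner_neg_right, inner_neg_right, inner_smul_right, inner_smul_right]
      linarith
    refine ⟨-(N • v), ⟨_, hub⟩, ?_⟩
    have h1 := (isLUB_conj hψ ⟨_, hub⟩).2 hub
    have h2 := le_abs_self (conj ψ 0 + t)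
    rw [norm_neg, norm_smul, Real.norm_of_nonneg hN0]
    linarith
  · have hub : inner ℝ x (-(κ⁻¹ • v)) - 3 / 4 * δ * (κ⁻¹ * ‖v‖) - t
        ∈ upperBounds (slopes ψ (-(κ⁻¹ • v))) := by
      rintro _ ⟨b, s, hb, rfl⟩
      have h2 := hsep b s hb
      have h3 := mul_le_mul_of_nonneg_left h2 (inv_nonneg.2 hκ0)
      have e1 : κ⁻¹ * (κ * t) = t := by field_simp
      have e2 : κ⁻¹ * (κ * s) = s := by field_simp
      rw [mul_add, mul_add, mul_add, e1, e2] at h3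
      rw [inner_neg_right, inner_neg_right, inner_smul_right, inner_smul_right]
      linarith
    refine ⟨-(κ⁻¹ • v), ⟨_, hub⟩, ?_⟩
    have h1 := (isLUB_conj hψ ⟨_, hub⟩).2 hub
    have h2 : 0 ≤ κ⁻¹ * ‖v‖ := by positivity
    rw [norm_neg, norm_smul, Real.norm_of_nonneg (inv_nonneg.2 hκ0)]
    nlinarith

/-! ### Choice of the directions -/

/-- The inradius of the domain of the conjugate about the origin. -/
def conjRadius (ψ : E n → EReal) : EReal := ⨅ y ∈ (conjDom ψ)ᶜ, ((‖y‖ : ℝ) : EReal)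

theorem mem_conjDom_of_lt {ψ : E n → EReal} {y : E n} (hy : ((‖y‖ : ℝ) : EReal) < conjRadius ψ) :
    y ∈ conjDom ψ := by
  by_contra h
  exact absurd hy (not_lt.2 (iInf₂_le y h))

theorem exists_notMem_conjDom {ψ : E n → EReal} {r : ℝ} (hr : conjRadius ψ < r) :
    ∃ y ∉ conjDom ψ, ‖y‖ < r := by
  obtain ⟨y, hy⟩ := iInf_lt_iff.1 hr
  obtain ⟨hyD, hy⟩ := iInf_lt_iff.1 hy
  exact ⟨y, hyD, EReal.coe_lt_coe_iff.1 hy⟩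

theorem exists_pos_lt_conjRadius {ψ : E n → EReal} (hψ : MemConvC ψ) :
    ∃ a : ℝ, 0 < a ∧ (a : EReal) < conjRadius ψ := by
  obtain ⟨a, ha, h⟩ := exists_ball_subset_conjDom hψ
  refine ⟨a / 2, by positivity, lt_of_lt_of_le (b := (a : EReal)) ?_ ?_⟩
  · exact EReal.coe_lt_coe_iff.2 (by linarith)
  · refine le_iInf₂ fun y hy => EReal.coe_le_coe_iff.2 ?_
    by_contra! hlt
    exact hy (h y hlt.le)

theorem convexOn_conj {ψ : E n → EReal} (hψ : MemConvC ψ) :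
    ConvexOn ℝ {y : E n | ((‖y‖ : ℝ) : EReal) < conjRadius ψ} (conj ψ) := by
  refine ⟨fun y hy z hz p q hp hq hpq => ?_, fun y hy z hz p q hp hq hpq => ?_⟩
  · have h1 : ‖p • y + q • z‖ ≤ max ‖y‖ ‖z‖ := by
      refine (norm_add_le _ _).trans ?_
      rw [norm_smul, norm_smul, Real.norm_of_nonneg hp, Real.norm_of_nonneg hq]
      have h2 := mul_le_mul_of_nonneg_left (le_max_left ‖y‖ ‖z‖) hp
      have h3 := mul_le_mul_of_nonneg_left (le_max_right ‖y‖ ‖z‖) hq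
      have h4 : p * max ‖y‖ ‖z‖ + q * max ‖y‖ ‖z‖ = max ‖y‖ ‖z‖ := by
        rw [← add_mul, hpq, one_mul]
      linarith
    refine (EReal.coe_le_coe_iff.2 h1).trans_lt ?_
    rcases max_choice ‖y‖ ‖z‖ with h | h <;> rw [h]
    · exact hy
    · exact hz
  · exact (conj_combo hψ (mem_conjDom_of_lt hy) (mem_conjDom_of_lt hz) hp hq hpq).2

theorem continuousOn_conj {ψ : E n → EReal} (hψ : MemConvC ψ) {r : ℝ}
    (hr : (r : EReal) < conjRadius ψ) : ContinuousOn (conj ψ) (Metric.closedBall 0 r) := by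
  have hopen : IsOpen {y : E n | ((‖y‖ : ℝ) : EReal) < conjRadius ψ} :=
    isOpen_lt (continuous_coe_real_ereal.comp continuous_norm) continuous_const
  refine ((convexOn_conj hψ).continuousOn hopen).mono fun y hy => ?_
  exact (EReal.coe_le_coe_iff.2 (mem_closedBall_zero_iff.1 hy)).trans_lt hr

theorem exists_hasModulus_conj {ψ : E n → EReal} (hψ : MemConvC ψ) {r ε : ℝ}
    (hr : (r : EReal) < conjRadius ψ) (hε : 0 < ε) : ∃ δ > 0, HasModulus r ε δ (conj ψ) := by
  have h := (isCompact_closedBall (0 : E n) r).uniformContinuousOn_of_continuous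
    (continuousOn_conj hψ hr)
  obtain ⟨δ, hδ, h⟩ := Metric.uniformContinuousOn_iff.1 h ε hε
  refine ⟨δ, hδ, fun y y' hy hy' hyy => ?_⟩
  have := h y (by simpa using hy) y' (by simpa using hy') (by rwa [dist_eq_norm])
  rw [Real.dist_eq] at this
  exact this.le

/-- The requirement that `h` vary little on spheres of radius at most `q`, if `q` is less than
`ρ`, and that `D` lie in the ball of radius `q`, if `q` is greater than `ρ`. -/
def Requirement (ρ : EReal) (i : ℚ × ℕ) (s : (E n → ℝ) × Set (E n)) : Prop :=
  (((i.1 : ℝ) : EReal) < ρ → HasOsc (Set.Iic (i.1 : ℝ)) (1 / (i.2 + 1)) s.1) ∧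
    (ρ < ((i.1 : ℝ) : EReal) → s.2 ⊆ Metric.closedBall 0 (i.1 : ℝ))

/-- One step of symmetrization of a conjugate function and its domain. -/
def conjStep (s : (E n → ℝ) × Set (E n)) (u : UnitVec n) : (E n → ℝ) × Set (E n) :=
  (avg s.1 u, symPart s.2 u)

theorem foldl_conjStep (l : List (UnitVec n)) (s : (E n → ℝ) × Set (E n)) :
    l.foldl conjStep s = (l.foldl avg s.1, l.foldl symPart s.2) := by
  induction l generalizing s with
  | nil => rfl
  | cons u l ih => exact ih _

theorem Requirement.conjStep {ρ : EReal} {i : ℚ × ℕ} {s : (E n → ℝ) × Set (E n)}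
    (h : Requirement ρ i s) (u : UnitVec n) : Requirement ρ i (conjStep s u) :=
  ⟨fun hi => (h.1 hi).avg u, fun hi => fun _ hy => h.2 hi hy.1⟩

/-- Below the critical radius the conjugate is bounded and uniformly continuous on the closed ball,
and both bounds survive the steps already taken. Above it, a missing point is pushed out to norm
`i.1`, where a whole neighbourhood is missing. At the critical radius nothing is required. -/
theorem exists_list_requirement {ψ : E n → EReal} (hψ : MemConvC ψ) (l : List (UnitVec n))
    (i : ℚ × ℕ) : ∃ l' : List (UnitVec n), Requirement (conjRadius ψ) i
      ((l ++ l').foldl conjStep (conj ψ, conjDom ψ)) := by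
  rcases lt_trichotomy ((i.1 : ℝ) : EReal) (conjRadius ψ) with hi | hi | hi
  · have hε : (0 : ℝ) < 1 / 4 * (1 / (i.2 + 1)) := by positivity
    obtain ⟨δ, hδ, hmod⟩ := exists_hasModulus_conj hψ hi hε
    obtain ⟨B, hB⟩ := (isCompact_closedBall (0 : E n) i.1).exists_bound_of_continuousOn
      (continuousOn_conj hψ hi)
    obtain ⟨l', hl'⟩ := exists_list_hasOsc hε hδ
      (foldl_avg_induction (fun _ u hh => hh.avg u) l hmod)
      (foldl_avg_induction (P := fun h => ∀ y, ‖y‖ ≤ (i.1 : ℝ) → |h y| ≤ B)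
        (fun _ u hh => abs_avg_le hh u) l fun y hy => hB y (by simpa using hy))
    refine ⟨l', fun _ => ?_, fun h => absurd h (not_lt.2 hi.le)⟩
    rw [foldl_conjStep, List.foldl_append]
    convert hl' using 1
    ring
  · exact ⟨[], fun h => absurd hi h.ne, fun h => absurd hi h.ne'⟩
  · obtain ⟨y₀, hy₀, hlt⟩ := exists_notMem_conjDom hi
    obtain ⟨a, ha, hball⟩ := exists_ball_subset_conjDom hψ
    have hpos : 0 < ‖y₀‖ := by
      refine norm_pos_iff.2 fun h => hy₀ ?_
      rw [h]
      exact hball 0 (by simpa using ha.le)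
    set k : ℝ := i.1 / ‖y₀‖ with hk
    have hk1 : 1 < k := (one_lt_div hpos).2 hlt
    have hz : ‖k • y₀‖ = i.1 := by
      rw [norm_smul, Real.norm_of_nonneg (by linarith), hk, div_mul_cancel₀ _ hpos.ne']
    -- Otherwise `y₀` would be a convex combination of `y` and a point of the small ball about the
    -- origin, both in the convex domain.
    have hmiss : ∀ y, ‖y - k • y₀‖ < a * (k - 1) → y ∉ conjDom ψ := by
      intro y hy hyD
      refine hy₀ ?_
      have hw : (k - 1)⁻¹ • (k • y₀ - y) ∈ conjDom ψ := by
        refine hball _ ?_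
        rw [norm_smul, norm_inv, Real.norm_of_nonneg (by linarith), norm_sub_rev,
          inv_mul_le_iff₀ (by linarith)]
        linarith
      have hk0 : k ≠ 0 := by linarith
      have hk2 : k - 1 ≠ 0 := by linarith
      have h1 := (conj_combo hψ hyD hw (p := k⁻¹) (q := 1 - k⁻¹) (by positivity)
        (sub_nonneg.2 (inv_le_one_of_one_le₀ hk1.le)) (by ring)).1
      have e : k⁻¹ • y + (1 - k⁻¹) • (k - 1)⁻¹ • (k • y₀ - y) = y₀ := by
        have e1 : (1 - k⁻¹) * (k - 1)⁻¹ = k⁻¹ := by field_simp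
        rw [smul_smul, e1, ← smul_add, add_sub_cancel, smul_smul, inv_mul_cancel₀ hk0, one_smul]
      rwa [e] at h1
    have hstar : ∀ y ∈ conjDom ψ, ∀ t ∈ Set.Icc (0 : ℝ) 1, t • y ∈ conjDom ψ := by
      intro y hy t ht
      have := (conj_combo hψ hy (hball 0 (by simpa using ha.le)) ht.1 (sub_nonneg.2 ht.2)
        (by ring)).1
      rwa [smul_zero, add_zero] at this
    have hstar' := foldl_symPart_induction
      (P := fun D => ∀ y ∈ D, ∀ t ∈ Set.Icc (0 : ℝ) 1, t • y ∈ D)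
      (fun D u hD y hy t ht => ⟨hD y hy.1 t ht, by rw [reflect_smul]; exact hD _ hy.2 t ht⟩)
      l hstar
    have hsub := foldl_symPart_induction (P := fun D => D ⊆ conjDom ψ)
      (fun D u hD y hy => hD hy.1) l subset_rfl
    obtain ⟨l', hl'⟩ := exists_list_subset_closedBall hstar'
      (mul_pos ha (sub_pos.2 hk1)) fun y hy hyD => hmiss y hy (hsub hyD)
    refine ⟨l', fun h => absurd h (not_lt.2 hi.le), fun _ => ?_⟩
    rw [foldl_conjStep, ← hz]
    simp only [List.foldl_append]
    exact hl'

/-- The conjugates of the successive symmetrizations become radial inside the ball of radius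
`conjRadius ψ`, and infinite outside. -/
structure IsGoodSeq (ψ : E n → EReal) (u : ℕ → E n) : Prop where
  unit : ∀ i, ‖u i‖ = 1
  mem_conjDom : ∀ m y, ((‖y‖ : ℝ) : EReal) < conjRadius ψ → y ∈ conjDom (iterSym u ψ m)
  osc : ∀ r : ℝ, (r : EReal) < conjRadius ψ → ∀ ε > 0, ∃ m₀, ∀ m ≥ m₀,
    HasOsc (Set.Iic r) ε (conj (iterSym u ψ m))
  subset : ∀ r : ℝ, conjRadius ψ < r → ∃ m₀, ∀ m ≥ m₀,
    conjDom (iterSym u ψ m) ⊆ Metric.closedBall 0 r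

theorem MemConvC.iterSym {ψ : E n → EReal} (hψ : MemConvC ψ) {u : ℕ → E n}
    (hu : ∀ i, ‖u i‖ = 1) (m : ℕ) : MemConvC (iterSym u ψ m) := by
  induction m with
  | zero => exact hψ
  | succ m ih => exact ih.minkSym (hu m)

theorem exists_isGoodSeq (hn : 1 ≤ n) {ψ : E n → EReal} (hψ : MemConvC ψ) :
    ∃ u, IsGoodSeq ψ u := by
  have : Nonempty (UnitVec n) := ⟨⟨EuclideanSpace.single ⟨0, hn⟩ 1, by simp⟩⟩
  obtain ⟨e, he⟩ := exists_surjective_nat (ℚ × ℕ)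
  obtain ⟨u, hu⟩ := exists_seq_forall_eventually conjStep (conj ψ, conjDom ψ)
    (fun j => Requirement (conjRadius ψ) (e j)) (fun _ _ u h => h.conjStep u)
    (fun l j => exists_list_requirement hψ l (e j))
  let x : ℕ → (E n → ℝ) × Set (E n) := fun m =>
    Nat.rec (conj ψ, conjDom ψ) (fun m s => conjStep s (u m)) m
  have hx : ∀ i : ℚ × ℕ, ∃ m₀, ∀ m ≥ m₀, Requirement (conjRadius ψ) i (x m) := by
    intro i
    obtain ⟨j, rfl⟩ := he i
    exact hu x rfl (fun m => rfl) j
  have hu1 : ∀ i, ‖(u i).1‖ = 1 := fun i => (u i).2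
  set v : ℕ → E n := fun i => (u i).1
  -- Outside its domain `conj` is a meaningless `sSup`, so the formal averages are identified with
  -- the conjugates only inside the ball, and the domains are controlled by inclusion only.
  have hinv : ∀ m, (∀ y : E n, ((‖y‖ : ℝ) : EReal) < conjRadius ψ →
      y ∈ conjDom (iterSym v ψ m) ∧ conj (iterSym v ψ m) y = (x m).1 y) ∧
      conjDom (iterSym v ψ m) ⊆ (x m).2 := by
    intro m
    induction m with
    | zero => exact ⟨fun y hy => ⟨mem_conjDom_of_lt hy, rfl⟩, subset_rfl⟩
    | succ m ih =>
      have hm := hψ.iterSym hu1 m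
      refine ⟨fun y hy => ?_, fun y hy => ?_⟩
      · obtain ⟨h1, h2⟩ := ih.1 y hy
        obtain ⟨h3, h4⟩ := ih.1 (reflect (v m) y) (by rwa [norm_reflect (hu1 m)])
        obtain ⟨h5, h6⟩ := conj_minkSym hm (hu1 m) h1 h3
        refine ⟨h5, h6.trans ?_⟩
        rw [h2, h4]
        rfl
      · obtain ⟨h1, h2⟩ := mem_conjDom_of_minkSym hm (hu1 m) hy
        exact ⟨ih.2 h1, ih.2 h2⟩
  refine ⟨v, hu1, fun m y hy => ((hinv m).1 y hy).1, fun r hr ε hε => ?_, fun r hr => ?_⟩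
  · obtain ⟨q, hrq, hq⟩ := EReal.lt_iff_exists_rat_btwn.1 hr
    obtain ⟨k, hk⟩ := exists_nat_one_div_lt hε
    obtain ⟨m₀, hm₀⟩ := hx (q, k)
    refine ⟨m₀, fun m hm y y' hy hy' => ?_⟩
    have hyr : ‖y‖ ≤ r := hy
    have hyρ : ((‖y‖ : ℝ) : EReal) < conjRadius ψ := (EReal.coe_le_coe_iff.2 hyr).trans_lt hr
    have h1 := (hm₀ m hm).1 hq y y' (hyr.trans (EReal.coe_lt_coe_iff.1 hrq).le) hy'
    rw [((hinv m).1 y hyρ).2, ((hinv m).1 y' (by rwa [hy'])).2]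
    exact h1.trans hk.le
  · obtain ⟨q, hq, hqr⟩ := EReal.lt_iff_exists_rat_btwn.1 hr
    obtain ⟨m₀, hm₀⟩ := hx (q, 0)
    refine ⟨m₀, fun m hm => (hinv m).2.trans (((hm₀ m hm).2 hq).trans ?_)⟩
    exact Metric.closedBall_subset_closedBall (EReal.coe_lt_coe_iff.1 hqr).le

/-! ### The limit -/

/-- The conjugate of `k` restricted to the open ball of radius `ρ`. -/
def ballConj (ρ : EReal) (k : E n → ℝ) (x : E n) : EReal :=
  ⨆ y : {y : E n // ((‖y‖ : ℝ) : EReal) < ρ}, ((inner ℝ x y.1 - k y.1 : ℝ) : EReal)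

theorem ballConj_le_coe_iff {ρ : EReal} {k : E n → ℝ} {x : E n} {t : ℝ} :
    ballConj ρ k x ≤ t ↔ ∀ y : E n, ((‖y‖ : ℝ) : EReal) < ρ → inner ℝ x y - k y ≤ t := by
  rw [ballConj, iSup_le_iff]
  exact ⟨fun h y hy => EReal.coe_le_coe_iff.1 (h ⟨y, hy⟩),
    fun h y => EReal.coe_le_coe_iff.2 (h y.1 y.2)⟩

theorem le_ballConj {ρ : EReal} (k : E n → ℝ) (x : E n) {y : E n}
    (hy : ((‖y‖ : ℝ) : EReal) < ρ) : ((inner ℝ x y - k y : ℝ) : EReal) ≤ ballConj ρ k x :=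
  le_iSup (fun y : {y : E n // ((‖y‖ : ℝ) : EReal) < ρ} => ((inner ℝ x y.1 - k y.1 : ℝ) : EReal))
    ⟨y, hy⟩

theorem ballConj_isometry {ρ : EReal} {k : E n → ℝ}
    (hk : ∀ y y' : E n, ((‖y‖ : ℝ) : EReal) < ρ → ‖y'‖ = ‖y‖ → k y' = k y)
    (T : E n ≃ₗᵢ[ℝ] E n) (x : E n) : ballConj ρ k (T x) = ballConj ρ k x := by
  have h : ∀ (T : E n ≃ₗᵢ[ℝ] E n) (x : E n), ballConj ρ k (T x) ≤ ballConj ρ k x := by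
    intro T x
    refine iSup_le fun y => ?_
    have hn : ‖T.symm y.1‖ = ‖y.1‖ := T.symm.norm_map _
    have h1 := le_ballConj k x (y := T.symm y.1) (by rw [hn]; exact y.2)
    rw [hk y.1 _ y.2 hn] at h1
    have h2 : inner ℝ (T x) y.1 = inner ℝ x (T.symm y.1) := by
      rw [← T.inner_map_map x, T.apply_symm_apply]
    rwa [h2]
  refine le_antisymm (h T x) ?_
  have := h T.symm (T x)
  rwa [T.symm_apply_apply] at this

/-- Coercivity: the test vector of norm `a` in the direction of `x` gives the bound `a * ‖x‖` minus
a constant, as `k` is constant on the sphere of radius `a`. Properness: the value at the origin is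
at most `-k 0`. -/
theorem memConvC_ballConj (hn : 1 ≤ n) {ρ : EReal} {k : E n → ℝ}
    (hk : ∀ y y' : E n, ((‖y‖ : ℝ) : EReal) < ρ → ‖y'‖ = ‖y‖ → k y' = k y)
    (hk0 : ∀ y : E n, ((‖y‖ : ℝ) : EReal) < ρ → k 0 ≤ k y) {a : ℝ} (ha : 0 < a)
    (haρ : (a : EReal) < ρ) : MemConvC (ballConj ρ k) where
  convex_epi := by
    rintro ⟨x, s⟩ hx ⟨y, t⟩ hy p q hp hq hpq
    simp only [Set.mem_ofPred_eq, Prod.smul_mk, Prod.mk_add_mk, smul_eq_mul,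
      ballConj_le_coe_iff] at hx hy ⊢
    intro z hz
    have h1 := mul_le_mul_of_nonneg_left (hx z hz) hp
    have h2 := mul_le_mul_of_nonneg_left (hy z hz) hq
    rw [inner_add_left, inner_smul_left, inner_smul_left, RCLike.conj_to_real,
      RCLike.conj_to_real]
    have h3 : k z = p * k z + q * k z := by rw [← add_mul, hpq, one_mul]
    linarith
  coercive := by
    set y₀ : E n := EuclideanSpace.single ⟨0, hn⟩ a
    have hy₀ : ‖y₀‖ = a := by simp [y₀, abs_of_pos ha]
    rw [EReal.tendsto_nhds_top_iff_real]
    intro t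
    filter_upwards [(tendsto_norm_cocompact_atTop (E := E n)).eventually
      (eventually_gt_atTop (max ((t + k y₀) / a) 0))] with x hx
    have hx0 : 0 < ‖x‖ := (le_max_right _ _).trans_lt hx
    have hx1 : t + k y₀ < ‖x‖ * a := (div_lt_iff₀ ha).1 ((le_max_left _ _).trans_lt hx)
    have hy : ‖(a / ‖x‖) • x‖ = a := by
      rw [norm_smul, Real.norm_of_nonneg (by positivity), div_mul_cancel₀ _ hx0.ne']
    refine lt_of_lt_of_le ?_ (le_ballConj k x (y := (a / ‖x‖) • x) (by rwa [hy]))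
    rw [hk y₀ _ (by rwa [hy₀]) (hy.trans hy₀.symm), inner_smul_right, real_inner_self_eq_norm_sq,
      EReal.coe_lt_coe_iff]
    have : a / ‖x‖ * ‖x‖ ^ 2 = ‖x‖ * a := by field_simp
    linarith
  ne_bot := fun x => ne_bot_of_coe_le (le_ballConj k x (y := 0) (by
    rw [norm_zero]
    exact (EReal.coe_lt_coe_iff.2 ha).trans haρ))
  dom_nonempty := by
    refine ⟨0, ne_top_of_le_ne_top (EReal.coe_ne_top (-k 0)) (ballConj_le_coe_iff.2 ?_)⟩
    intro y hy
    rw [inner_zero_left]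
    linarith [hk0 y hy]
  lsc := by
    refine lowerSemicontinuous_iSup fun y => Continuous.lowerSemicontinuous ?_
    exact continuous_coe_real_ereal.comp (by fun_prop)

/-- The pointwise limit of the conjugates of the successive symmetrizations. -/
def limConj (u : ℕ → E n) (ψ : E n → EReal) (y : E n) : ℝ :=
  limUnder atTop fun m => conj (iterSym u ψ m) y

theorem IsGoodSeq.abs_conj_sub_le {ψ : E n → EReal} {u : ℕ → E n} (h : IsGoodSeq ψ u)
    (hψ : MemConvC ψ) {r ε : ℝ} (hr : (r : EReal) < conjRadius ψ) {m₀ : ℕ}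
    (hosc : HasOsc (Set.Iic r) ε (conj (iterSym u ψ m₀))) {m : ℕ} (hm : m₀ ≤ m) {y : E n}
    (hy : ‖y‖ ≤ r) : |conj (iterSym u ψ m) y - conj (iterSym u ψ m₀) y| ≤ ε := by
  have hyρ : ((‖y‖ : ℝ) : EReal) < conjRadius ψ := (EReal.coe_le_coe_iff.2 hy).trans_lt hr
  -- Later conjugates are averages of values of the one at `m₀` on the same sphere, so the induction
  -- must compare every point of that sphere with the fixed `y`.
  have key : ∀ y', ‖y'‖ = ‖y‖ → |conj (iterSym u ψ m) y' - conj (iterSym u ψ m₀) y| ≤ ε := by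
    induction m, hm using Nat.le_induction with
    | base =>
      intro y' hy'
      rw [abs_sub_comm]
      exact hosc y y' hy hy'
    | succ m _ ih =>
      intro y' hy'
      have hR : ‖reflect (u m) y'‖ = ‖y‖ := by rw [norm_reflect (h.unit m), hy']
      have h1 := abs_le.1 (ih y' hy')
      have h2 := abs_le.1 (ih _ hR)
      have h3 := (conj_minkSym (hψ.iterSym h.unit m) (h.unit m)
        (h.mem_conjDom m y' (by rwa [hy'])) (h.mem_conjDom m _ (by rwa [hR]))).2
      have h4 : conj (iterSym u ψ (m + 1)) y'
        = (conj (iterSym u ψ m) y' + conj (iterSym u ψ m) (reflect (u m) y')) / 2 := h3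
      rw [h4, abs_le]
      constructor <;> linarith [h1.1, h1.2, h2.1, h2.2]
  exact key y rfl

theorem IsGoodSeq.tendsto_limConj {ψ : E n → EReal} {u : ℕ → E n} (h : IsGoodSeq ψ u)
    (hψ : MemConvC ψ) {y : E n} (hy : ((‖y‖ : ℝ) : EReal) < conjRadius ψ) :
    Tendsto (fun m => conj (iterSym u ψ m) y) atTop (𝓝 (limConj u ψ y)) := by
  refine tendsto_nhds_limUnder (cauchySeq_tendsto_of_complete ?_)
  refine Metric.cauchySeq_iff'.2 fun ε hε => ?_
  obtain ⟨m₀, hm₀⟩ := h.osc ‖y‖ hy (ε / 2) (by positivity)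
  refine ⟨m₀, fun m hm => ?_⟩
  rw [Real.dist_eq]
  exact (h.abs_conj_sub_le hψ hy (hm₀ m₀ le_rfl) hm le_rfl).trans_lt (by linarith)

theorem IsGoodSeq.eventually_abs_sub_le {ψ : E n → EReal} {u : ℕ → E n} (h : IsGoodSeq ψ u)
    (hψ : MemConvC ψ) {r ε : ℝ} (hr : (r : EReal) < conjRadius ψ) (hε : 0 < ε) :
    ∀ᶠ m in atTop, ∀ y : E n, ‖y‖ ≤ r → |conj (iterSym u ψ m) y - limConj u ψ y| ≤ ε := by
  obtain ⟨m₀, hm₀⟩ := h.osc r hr ε hε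
  filter_upwards [eventually_ge_atTop m₀] with m hm y hy
  have hyρ : ((‖y‖ : ℝ) : EReal) < conjRadius ψ := (EReal.coe_le_coe_iff.2 hy).trans_lt hr
  have h2 : Tendsto (fun m' => |conj (iterSym u ψ m) y - conj (iterSym u ψ m') y|) atTop
      (𝓝 |conj (iterSym u ψ m) y - limConj u ψ y|) :=
    (tendsto_const_nhds.sub (h.tendsto_limConj hψ hyρ)).abs
  refine le_of_tendsto h2 ?_
  filter_upwards [eventually_ge_atTop m] with m' hm'
  rw [abs_sub_comm]
  exact h.abs_conj_sub_le hψ hr (hm₀ m hm) hm' hy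

theorem IsGoodSeq.limConj_eq {ψ : E n → EReal} {u : ℕ → E n} (h : IsGoodSeq ψ u)
    (hψ : MemConvC ψ) {y y' : E n} (hy : ((‖y‖ : ℝ) : EReal) < conjRadius ψ)
    (hy' : ‖y'‖ = ‖y‖) : limConj u ψ y' = limConj u ψ y := by
  refine tendsto_nhds_unique (h.tendsto_limConj hψ (by rwa [hy'])) ?_
  have h1 := h.tendsto_limConj hψ hy
  have h2 : Tendsto (fun m => conj (iterSym u ψ m) y' - conj (iterSym u ψ m) y) atTop (𝓝 0) := by
    rw [Metric.tendsto_atTop]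
    intro ε hε
    obtain ⟨m₀, hm₀⟩ := h.osc ‖y‖ hy (ε / 2) (by positivity)
    refine ⟨m₀, fun m hm => ?_⟩
    rw [Real.dist_eq, sub_zero, abs_sub_comm]
    exact (hm₀ m hm y y' (Set.mem_Iic.2 le_rfl) hy').trans_lt (by linarith)
  simpa using h2.add h1

theorem IsGoodSeq.limConj_zero_le {ψ : E n → EReal} {u : ℕ → E n} (h : IsGoodSeq ψ u)
    (hψ : MemConvC ψ) {y : E n} (hy : ((‖y‖ : ℝ) : EReal) < conjRadius ψ) :
    limConj u ψ 0 ≤ limConj u ψ y := by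
  have hy' : ((‖-y‖ : ℝ) : EReal) < conjRadius ψ := by rwa [norm_neg]
  have h0 : ((‖(0 : E n)‖ : ℝ) : EReal) < conjRadius ψ :=
    (EReal.coe_le_coe_iff.2 (by simp)).trans_lt hy
  have h1 := ((h.tendsto_limConj hψ hy).const_mul (1 / 2)).add
    ((h.tendsto_limConj hψ hy').const_mul (1 / 2))
  rw [h.limConj_eq hψ hy (norm_neg y)] at h1
  have h2 : limConj u ψ 0 ≤ 1 / 2 * limConj u ψ y + 1 / 2 * limConj u ψ y := by
    refine le_of_tendsto_of_tendsto' (h.tendsto_limConj hψ h0) h1 fun m => ?_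
    have := (conj_combo (hψ.iterSym h.unit m) (h.mem_conjDom m y hy) (h.mem_conjDom m _ hy')
      (p := 1 / 2) (q := 1 / 2) (by norm_num) (by norm_num) (by norm_num)).2
    rwa [smul_neg, add_neg_cancel] at this
  linarith

/-- Eventually, the conjugate domain is so close to the ball of radius `conjRadius ψ`, or this
radius is so large, that slopes beyond a suitable radius `r` are harmless. -/
theorem IsGoodSeq.exists_radius {ψ : E n → EReal} {u : ℕ → E n} (h : IsGoodSeq ψ u)
    (hψ : MemConvC ψ) {Q η δ : ℝ} (hQ : 0 < Q) (hη : 0 < η) (hδ : 0 < δ) :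
    ∃ r : ℝ, 0 < r ∧ (r : EReal) < conjRadius ψ ∧ ∀ᶠ m in atTop, ∀ y ∈ conjDom (iterSym u ψ m),
      r < ‖y‖ → (1 - r / ‖y‖) * Q < η + δ * r := by
  obtain ⟨a, ha, haρ⟩ := exists_pos_lt_conjRadius hψ
  rcases eq_or_ne (conjRadius ψ) ⊤ with htop | htop
  -- With this radius `δ * r = Q`, and the factor in front of `Q` is at most 1.
  · refine ⟨Q / δ, by positivity, htop ▸ EReal.coe_lt_top _, Eventually.of_forall ?_⟩
    intro m y _ hy
    have h1 : 0 ≤ Q / δ / ‖y‖ := by positivity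
    have h2 : δ * (Q / δ) = Q := by field_simp
    rw [h2]
    nlinarith
  · obtain ⟨R, hR⟩ : ∃ R : ℝ, conjRadius ψ = R :=
      ⟨(conjRadius ψ).toReal, (EReal.coe_toReal htop (haρ.trans' (EReal.bot_lt_coe a)).ne').symm⟩
    have hR0 : 0 < R := by
      rw [hR] at haρ
      exact ha.trans (EReal.coe_lt_coe_iff.1 haρ)
    -- The domain is eventually inside the ball of radius `R (1 + θ)`, and `r = R (1 - θ)`; then `1
    -- - r / ‖y‖ ≤ 2 θ` and `2 θ Q ≤ η / 2`.
    set θ := min (1 / 2) (η / (4 * Q)) with hθ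
    have hθ0 : 0 < θ := lt_min (by norm_num) (by positivity)
    have hθ1 : θ ≤ 1 / 2 := min_le_left _ _
    have hθ2 : θ * (4 * Q) ≤ η := (le_div_iff₀ (by positivity)).1 (min_le_right _ _)
    obtain ⟨m₀, hm₀⟩ := h.subset (R * (1 + θ)) (by
      rw [hR]
      exact EReal.coe_lt_coe_iff.2 (by nlinarith))
    refine ⟨R * (1 - θ), by nlinarith, ?_, ?_⟩
    · rw [hR]
      exact EReal.coe_lt_coe_iff.2 (by nlinarith)
    · filter_upwards [eventually_ge_atTop m₀] with m hm y hy hry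
      have hyn := mem_closedBall_zero_iff.1 (hm₀ m hm hy)
      have hr0 : 0 < R * (1 - θ) := by nlinarith
      have hy0 : 0 < ‖y‖ := hr0.trans hry
      have h1 : 1 - 2 * θ ≤ R * (1 - θ) / ‖y‖ := by
        rw [le_div_iff₀ hy0]
        have : (1 - 2 * θ) * ‖y‖ ≤ (1 - 2 * θ) * (R * (1 + θ)) :=
          mul_le_mul_of_nonneg_left hyn (by linarith)
        nlinarith [mul_pos hR0 (mul_pos hθ0 hθ0)]
      have h2 : (1 - R * (1 - θ) / ‖y‖) * Q ≤ 2 * θ * Q :=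
        mul_le_mul_of_nonneg_right (by linarith) hQ.le
      have h3 : 0 < δ * (R * (1 - θ)) := by positivity
      linarith

/-- If an iterate were at least `t` near `x`, separation would give a slope `y` with a small
conjugate value. For `‖y‖ ≤ r` this contradicts uniform convergence to `limConj`. For larger `‖y‖`,
convexity moves the estimate to `(r / ‖y‖) • y`; the loss is at most `(1 - r / ‖y‖) * Q`, which
`exists_radius` makes smaller than the available margin. -/
theorem IsGoodSeq.eventually_exists_lt {ψ : E n → EReal} {u : ℕ → E n} (h : IsGoodSeq ψ u)
    (hψ : MemConvC ψ) {x : E n} {t δ : ℝ} (hδ : 0 < δ)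
    (hx : ballConj (conjRadius ψ) (limConj u ψ) x < t) :
    ∀ᶠ m in atTop, ∃ x', ‖x' - x‖ < δ ∧ iterSym u ψ m x' < t := by
  obtain ⟨t', ht', htt'⟩ := EReal.lt_iff_exists_real_btwn.1 hx
  have htt := EReal.coe_lt_coe_iff.1 htt'
  have hle := ballConj_le_coe_iff.1 ht'.le
  set Q := |limConj u ψ 0 + 1 + t| + 1 with hQ
  have hQ0 : 0 < Q := by positivity
  obtain ⟨r, hr0, hr, hrad⟩ := h.exists_radius hψ hQ0 (η := (t - t') / 2) (δ := δ / 2)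
    (by linarith) (by linarith)
  filter_upwards [hrad, h.eventually_abs_sub_le hψ hr (ε := (t - t') / 4) (by linarith),
    h.eventually_abs_sub_le hψ hr (ε := 1) one_pos] with m hm1 hm2 hm3
  have hm := hψ.iterSym h.unit m
  by_contra! hno
  obtain ⟨y, hyD, hy⟩ := exists_conj_add_le hm hδ hno
  have hlow : ∀ z : E n, ‖z‖ ≤ r →
      inner ℝ x z - t' - (t - t') / 4 ≤ conj (iterSym u ψ m) z := by
    intro z hz
    have h1 := hle z ((EReal.coe_le_coe_iff.2 hz).trans_lt hr)
    have h2 := (abs_le.1 (hm2 z hz)).1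
    linarith
  rcases le_or_gt ‖y‖ r with hyr | hyr
  · have h1 := hlow y hyr
    have h2 : 0 ≤ δ / 2 * ‖y‖ := by positivity
    linarith
  · have hy0 : 0 < ‖y‖ := hr0.trans hyr
    have h0D : (0 : E n) ∈ conjDom (iterSym u ψ m) := h.mem_conjDom m 0 (by
      rw [norm_zero]
      exact (EReal.coe_lt_coe_iff.2 hr0).trans hr)
    set s := r / ‖y‖ with hs
    have hs0 : 0 ≤ s := by positivity
    have hs1 : s ≤ 1 := (div_le_one hy0).2 hyr.le
    have hsy : s * ‖y‖ = r := div_mul_cancel₀ _ hy0.ne'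
    have h1 := (conj_combo hm hyD h0D hs0 (sub_nonneg.2 hs1) (by ring)).2
    rw [smul_zero, add_zero] at h1
    have h2 := hlow (s • y) (by rw [norm_smul, Real.norm_of_nonneg hs0, hsy])
    rw [inner_smul_right] at h2
    have h3 := mul_le_mul_of_nonneg_left hy hs0
    have h4 : s * (δ / 2 * ‖y‖) = δ / 2 * r := by rw [← hsy]; ring
    have h5 : conj (iterSym u ψ m) 0 + t ≤ Q := by
      have := (abs_le.1 (hm3 0 (by simpa using hr0.le))).2
      have := le_abs_self (limConj u ψ 0 + 1 + t)
      linarith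
    have h6 := mul_le_mul_of_nonneg_left h5 (sub_nonneg.2 hs1)
    have h7 := hm1 y hyD hyr
    rw [mul_add, h4, mul_sub] at h3
    rw [mul_add] at h6
    linarith

/-- Diagonal choice: the infimum of the admissible tolerances at `m`, plus `1 / (m + 1)` so that it
is eventually admissible itself. -/
theorem exists_tendsto_zero_of_eventually {P : ℕ → ℝ → Prop}
    (hmono : ∀ m a b, a ≤ b → P m a → P m b) (h : ∀ ε > 0, ∀ᶠ m in atTop, P m ε) :
    ∃ ε : ℕ → ℝ, Tendsto ε atTop (𝓝 0) ∧ ∀ᶠ m in atTop, P m (ε m) := by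
  have hbdd : ∀ m, BddBelow {a : ℝ | 0 < a ∧ P m a} := fun m => ⟨0, fun a ha => ha.1.le⟩
  refine ⟨fun m => sInf {a : ℝ | 0 < a ∧ P m a} + 1 / ((m : ℝ) + 1), ?_, ?_⟩
  · have h1 : Tendsto (fun m => sInf {a : ℝ | 0 < a ∧ P m a}) atTop (𝓝 0) := by
      refine (nhds_basis_Ioo_pos (0 : ℝ)).tendsto_right_iff.2 fun ε hε => ?_
      filter_upwards [h (ε / 2) (by positivity)] with m hm
      have h2 : sInf {a : ℝ | 0 < a ∧ P m a} ≤ ε / 2 :=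
        csInf_le (hbdd m) ⟨by positivity, hm⟩
      have h3 : 0 ≤ sInf {a : ℝ | 0 < a ∧ P m a} := Real.sInf_nonneg fun a ha => ha.1.le
      constructor <;> linarith
    simpa using h1.add tendsto_one_div_add_atTop_nhds_zero_nat
  · filter_upwards [h 1 one_pos] with m hm
    have hne : {a : ℝ | 0 < a ∧ P m a}.Nonempty := ⟨1, one_pos, hm⟩
    obtain ⟨a, ha, hlt⟩ := exists_lt_of_csInf_lt hne
      (lt_add_of_pos_right (sInf {a : ℝ | 0 < a ∧ P m a})
        (show (0 : ℝ) < 1 / ((m : ℝ) + 1) by positivity))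
    exact hmono m a _ hlt.le ha.2

theorem IsGoodSeq.ballConj_le_liminf {ψ : E n → EReal} {u : ℕ → E n} (h : IsGoodSeq ψ u)
    (hψ : MemConvC ψ) {x : E n} {xs : ℕ → E n} (hxs : Tendsto xs atTop (𝓝 x)) :
    ballConj (conjRadius ψ) (limConj u ψ) x
      ≤ liminf (fun m => iterSym u ψ m (xs m)) atTop := by
  refine iSup_le fun y => ?_
  have h1 : Tendsto (fun m => ((inner ℝ (xs m) y.1 - conj (iterSym u ψ m) y.1 : ℝ) : EReal)) atTop
      (𝓝 ((inner ℝ x y.1 - limConj u ψ y.1 : ℝ) : EReal)) :=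
    EReal.tendsto_coe.2 ((hxs.inner tendsto_const_nhds).sub (h.tendsto_limConj hψ y.2))
  rw [← h1.liminf_eq]
  refine liminf_le_liminf (Eventually.of_forall fun m => ?_)
  exact inner_sub_conj_le (hψ.iterSym h.unit m) (h.mem_conjDom m _ y.2) _

theorem IsGoodSeq.epiTendsto {ψ : E n → EReal} {u : ℕ → E n} (h : IsGoodSeq ψ u)
    (hψ : MemConvC ψ) :
    EpiTendsto (iterSym u ψ) (ballConj (conjRadius ψ) (limConj u ψ)) := by
  intro x
  refine ⟨fun xs hxs => h.ballConj_le_liminf hψ hxs, ?_⟩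
  set φ := ballConj (conjRadius ψ) (limConj u ψ)
  obtain ⟨a, ha, haρ⟩ := exists_pos_lt_conjRadius hψ
  have hbot : φ x ≠ ⊥ := ne_bot_of_coe_le (le_ballConj _ x (y := 0) (by
    rw [norm_zero]
    exact (EReal.coe_lt_coe_iff.2 ha).trans haρ))
  rcases eq_or_ne (φ x) ⊤ with htop | htop
  · refine ⟨fun _ => x, tendsto_const_nhds, ?_⟩
    refine tendsto_of_le_liminf_of_limsup_le (h.ballConj_le_liminf hψ tendsto_const_nhds) ?_
    rw [htop]
    exact le_top
  · have hv := EReal.coe_toReal htop hbot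
    set v := (φ x).toReal
    obtain ⟨ε, hε, hP⟩ := exists_tendsto_zero_of_eventually
      (P := fun m ε => ∃ x', ‖x' - x‖ < ε ∧ iterSym u ψ m x' < ((v + ε : ℝ) : EReal))
      (fun m a b hab ⟨x', h1, h2⟩ => ⟨x', h1.trans_le hab,
        h2.trans_le (EReal.coe_le_coe_iff.2 (by linarith))⟩)
      (fun ε hε => h.eventually_exists_lt hψ hε (by
        change φ x < _
        rw [← hv]
        exact EReal.coe_lt_coe_iff.2 (by linarith)))
    -- At the finitely many indices with no suitable point the choice is arbitrary.
    have hchoice : ∀ m, ∃ x', (∃ x', ‖x' - x‖ < ε m ∧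
        iterSym u ψ m x' < ((v + ε m : ℝ) : EReal)) →
        ‖x' - x‖ < ε m ∧ iterSym u ψ m x' < ((v + ε m : ℝ) : EReal) := fun m => by
      by_cases hm : ∃ x', ‖x' - x‖ < ε m ∧ iterSym u ψ m x' < ((v + ε m : ℝ) : EReal)
      · obtain ⟨x', hx'⟩ := hm
        exact ⟨x', fun _ => hx'⟩
      · exact ⟨x, fun h => absurd h hm⟩
    choose xs hxs using hchoice
    have hlim : Tendsto xs atTop (𝓝 x) := by
      rw [tendsto_iff_norm_sub_tendsto_zero]
      refine squeeze_zero' (Eventually.of_forall fun m => norm_nonneg _) ?_ hε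
      filter_upwards [hP] with m hm
      exact (hxs m hm).1.le
    refine ⟨xs, hlim, tendsto_of_le_liminf_of_limsup_le (h.ballConj_le_liminf hψ hlim) ?_⟩
    have h1 : Tendsto (fun m => ((v + ε m : ℝ) : EReal)) atTop (𝓝 (v : EReal)) :=
      EReal.tendsto_coe.2 (by simpa using tendsto_const_nhds.add hε)
    change _ ≤ φ x
    rw [← hv, ← h1.limsup_eq]
    refine limsup_le_limsup ?_
    filter_upwards [hP] with m hm
    exact (hxs m hm).2.le

/-- Every function of `Conv_c(ℝⁿ)` has an epi-symmetrization. -/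
theorem MemConvC.exists_isEpiSymmetrization (hn : 1 ≤ n) {ψ : E n → EReal} (hψ : MemConvC ψ) :
    ∃ φ, IsEpiSymmetrization ψ φ := by
  obtain ⟨u, h⟩ := exists_isGoodSeq hn hψ
  obtain ⟨a, ha, haρ⟩ := exists_pos_lt_conjRadius hψ
  have hk : ∀ y y' : E n, ((‖y‖ : ℝ) : EReal) < conjRadius ψ → ‖y'‖ = ‖y‖ →
      limConj u ψ y' = limConj u ψ y := fun y y' hy hy' => h.limConj_eq hψ hy hy'
  exact ⟨ballConj (conjRadius ψ) (limConj u ψ),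
    memConvC_ballConj hn hk (fun y hy => h.limConj_zero_le hψ hy) ha haρ,
    ballConj_isometry hk, u, h.unit, h.epiTendsto hψ⟩

end HypoSym

end

open HypoSym in
theorem theorem6p1 (n : ℕ) (hn : 1 ≤ n) (α : ℝ) (hα : -1 / (n : ℝ) ≤ α) :
    (∀ f : E n → ℝ, MemC α f → ∃ g : E n → ℝ, IsHypoSymmetrization α f g) ∧
    (∀ f g : E n → ℝ, MemC α f → IsHypoSymmetrization α f g → MemC α g) ∧
    (∀ F : (E n → ℝ) → ℝ, PosOn α F → HypoLSC α F → OrthInvariant α F → SupConvConvex α F →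
      ∀ f g : E n → ℝ, MemC α f → IsHypoSymmetrization α f g → F f ≥ F g) ∧
    (∀ F : (E n → ℝ) → ℝ, PosOn α F → HypoUSC α F → OrthInvariant α F → SupConvConcave α F →
      ∀ f g : E n → ℝ, MemC α f → IsHypoSymmetrization α f g → F f ≤ F g) := by
  refine ⟨fun f hf => ?_, fun f g hf hg => hg.memC hf,
    fun F hpos hlsc hO hF f g hf hg => hg.le hpos hlsc hO hF hf,
    fun F hpos husc hO hF f g hf hg => hg.ge hpos husc hO hF hf⟩
  obtain ⟨φ, hφ⟩ := hf.memConvC_base.exists_isEpiSymmetrization hn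
  exact ⟨ofBase α φ, φ, hφ, rfl⟩
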